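/- Let $X_1,X_2,\dots$ be i.i.d. real random variables with distribution function $F$, absolutely continuous with density $f$; put $\overline F=1-F$, $r(F)=\sup\{x:F(x)<1\}\le\infty$, $F^{\leftarrow}(p)=\inf\{x:F(x)>p\}$ and $M_n=\max(X_1,\dots,X_n)$. Let $\beta>1$, and for a density $h$ let $H_\beta(h)=\frac1{1-\beta}\log\int_{\{h>0\}}h(x)^\beta\,dx$ be its Rényi entropy of order $\beta$. Assume one of the following. (a) (Fréchet case) For some $\alpha>0$ with $\beta-1>(1+\alpha)^{-1}$ the von Mises condition $\lim_{x\to\infty}xf(x)/\overline F(x)=\alpha$ holds; put $a_n=F^{\leftarrow}(1-1/n)$, $b_n=0$, and let $g(x)=\alpha x^{-(\alpha+1)}e^{-x^{-\alpha}}$ for $x>0$, $g(x)=0$ for $x\le 0$. (b) (Gumbel case) The von Mises condition $\lim_{x\uparrow r(F)}f(x)\int_x^{r(F)}\overline F(t)\,dt\,/\,\overline F(x)^2=1$ holds; put $b_n=F^{\leftarrow}(1-1/n)$, $a_n=\int_{b_n}^{r(F)}\overline F(t)\,dt/\overline F(b_n)$, and let $g(x)=e^{-x}e^{-e^{-x}}$,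 $x\in\mathbb R$. For all large $n$ let $g_n$ be a density of $(M_n-b_n)/a_n$, and suppose that there are $\varepsilon>0$ and $N$ with $\sup_{x\in\mathbb R}|g_n(x)-g(x)|<\varepsilon$ for all $n\ge N$. If $\int_{\mathbb R}g(x)^\beta\,dx<\infty$ and $\int_{\mathbb R}f(x)^{\beta-1}\,dx<\infty$, then there are constants $M,M_2>0$, not depending on $n$, such that for all large $n$ $$\int_{\mathbb R}g_n(x)^\beta\,dx<\infty,\qquad \int_{\mathbb R}|g_n(x)-g(x)|^{\beta-1}\,dx<M_2,\qquad |H_\beta(g_n)-H_\beta(g)|<M\sup_{x\in\mathbb R}|g_n(x)-g(x)|.$$ -/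

import Mathlib

open MeasureTheory ProbabilityTheory Filter Topology

noncomputable section

namespace RenyiExtremes

/-- The Rényi entropy of order `β` of a density `f`. -/
def renyiEntropy (β : ℝ) (f : ℝ → ℝ) : ℝ :=
  1 / (1 - β) * Real.log (∫ x in {x | 0 < f x}, f x ^ β)

/-- `g` is a (pointwise defined) Lebesgue density of the measure `ν` on the line. -/
def IsDensity (g : ℝ → ℝ) (ν : Measure ℝ) : Prop :=
  Measurable g ∧ (∀ x, 0 ≤ g x) ∧ ν = volume.withDensity (fun x => ENNReal.ofReal (g x))

/-- The partial maximum of the first `n` variables (meaningful for `n ≥ 1`). -/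
def partialMax {Ω : Type*} (X : ℕ → Ω → ℝ) (n : ℕ) (ω : Ω) : ℝ :=
  ⨆ i : Fin n, X i ω

/-- The Fréchet density with parameter `α`. -/
def frechetDensity (α x : ℝ) : ℝ :=
  if x ≤ 0 then 0 else α * x ^ (-(α + 1)) * Real.exp (-x ^ (-α))

/-- The Gumbel density. -/
def gumbelDensity (x : ℝ) : ℝ :=
  Real.exp (-x) * Real.exp (-Real.exp (-x))

/-- The right extremity `sup {x : F x < 1}` of a distribution function, possibly `∞`. -/
def rightEnd (F : ℝ → ℝ) : EReal :=
  sSup ((fun x : ℝ => (x : EReal)) '' {x | F x < 1})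

/-- The inverse `inf {x : F x > p}` of a distribution function. -/
def quantile (F : ℝ → ℝ) (p : ℝ) : ℝ :=
  sInf {x | p < F x}

/-- The integral of the tail `1 - F` from `x` to the right extremity of `F`. -/
def tailIntegral (F : ℝ → ℝ) (x : ℝ) : ℝ :=
  ∫ t in {t : ℝ | x < t ∧ (t : EReal) < rightEnd F}, (1 - F t)

/-- The auxiliary function `u` of the Gumbel domain. -/
def auxFun (F : ℝ → ℝ) (x : ℝ) : ℝ :=
  tailIntegral F x / (1 - F x)

/-- The von Mises condition for the Fréchet law with parameter `α`. -/
def VonMisesFrechet (F f : ℝ → ℝ) (α : ℝ) : Prop :=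
  Tendsto (fun x => x * f x / (1 - F x)) atTop (𝓝 α)

/-- The von Mises condition for the Gumbel law; the limit is taken as the real variable `x`
increases to the right extremity of `F`. -/
def VonMisesGumbel (F f : ℝ → ℝ) : Prop :=
  Tendsto (fun x => f x * tailIntegral F x / (1 - F x) ^ 2)
    (comap (fun x : ℝ => (x : EReal)) (𝓝[<] (rightEnd F))) (𝓝 1)

end RenyiExtremes

end

open RenyiExtremes

/-! The mean value theorem bounds `|x ^ β - y ^ β|` by `β (x ^ (β-1) + y ^ (β-1)) |x - y|`, so `∫
gₙ^β` and `∫ g^β` differ by at most `β (∫ gₙ^(β-1) + ∫ g^(β-1))` times the sup-distance. The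
logarithm is Lipschitz away from `0`. Hence everything rests on an upper bound for `∫ gₙ^(β-1)` and
a positive lower bound for `∫ gₙ^β`, both uniform in `n`. Strictness also needs `gₙ ≠ g`, and the
two distribution functions do differ where `a n * x + b n` is the quantile: there they equal `(1 -
1/n)^n` and `e⁻¹`.

For `β ≥ 2` the upper bound is cheap: `h ^ (β-1) ≤ h + h ^ β`, and `∫ gₙ^β` is bounded because `gₙ`
is uniformly close to `g`. For `p = β - 1 < 1` the enemy is mass spread thinly over a long range,
and the line is cut at a fixed level `y₀` of the unnormalized variable with `F y₀ < 1`. Below it,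
`gₙ(x) ≤ n F(y₀)^(n-1) a f(a x + b)` almost everywhere; the geometric factor beats every power of
`n`, while `c / n ≤ a n` controls the scaling factor `a ^ (p-1)` (`exists_mul_pow_rpow_bound`).
Above it, the law of the maximum has polynomial tails of some order `k` with `p (1 + k) > 1`, hence
enough moments to bound `∫ gₙ^p` (`exists_lintegral_rpow_bound`). The same tails keep half of the
mass in a fixed interval, which bounds `∫ gₙ^β` from below.

The tails (`TailControl`) come from the von Mises conditions read as differential inequalities for
`S = 1 - F`. In the Fréchet case `S(t) t^k` is eventually decreasing for `k < α`. In the Gumbel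
case, with `T` the tail integral, so that `T' = -S`, the product `S T^(-(1-δ))` decreases and `S
T^(-(1+δ))` increases near the right end; integrating again yields decay of order `(1-δ)/δ`, which
is arbitrarily large. -/

namespace RenyiExtremes

/-! ### Monotonicity from differential inequalities -/

/-- Integration by parts for a primitive of an integrable function against a `C¹` weight. -/
theorem mul_sub_mul_eq_integral_of_primitive {f S W W' : ℝ → ℝ} {y z : ℝ} (hyz : y ≤ z)
    (hf : IntervalIntegrable f volume y z)
    (hS : ∀ t ∈ Set.Icc y z, S t = S y - ∫ s in y..t, f s)
    (hW : ∀ t ∈ Set.Icc y z, HasDerivAt W (W' t) t) (hW' : ContinuousOn W' (Set.Icc y z)) :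
    S z * W z - S y * W y = ∫ t in y..z, (S t * W' t - f t * W t) := by
  rcases hyz.eq_or_lt with h | h
  · simp [h]
  have hI := Set.uIcc_of_le hyz
  set R : ℝ → ℝ := fun t => S y - ∫ s in y..t, f s with hR
  have hRac : AbsolutelyContinuousOnInterval R y z :=
    (LipschitzWith.const (S y)).lipschitzOnWith.absolutelyContinuousOnInterval.sub
      (hf.absolutelyContinuousOnInterval_intervalIntegral (by simp))
  have hWc : ContDiffOn ℝ 1 W (Set.uIcc y z) := by
    rw [hI, contDiffOn_one_iff_derivWithin (uniqueDiffOn_Icc h)]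
    refine ⟨fun t ht => (hW t ht).differentiableAt.differentiableWithinAt, hW'.congr ?_⟩
    intro t ht
    exact (hW t ht).hasDerivWithinAt.derivWithin (uniqueDiffOn_Icc h t ht)
  have key := hRac.integral_deriv_mul_eq_sub hWc.absolutelyContinuousOnInterval
  rw [hS z ⟨hyz, le_rfl⟩]
  have h1 : S y = R y := by simp [hR]
  rw [h1, show R y - ∫ s in y..z, f s = R z by simp [hR], ← key]
  apply intervalIntegral.integral_congr_ae
  filter_upwards [hf.ae_hasDerivAt_integral] with t ht hmem
  have hm : t ∈ Set.uIcc y z := Set.uIoc_subset_uIcc hmem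
  have h2 : HasDerivAt R (-f t) t := by
    simpa using (ht hm y (by simp)).const_sub (S y)
  rw [hI] at hm
  rw [h2.deriv, (hW t hm).deriv, hS t hm]
  simp only [hR]
  ring

/-- The density `f` is merely integrable, so `S` need not be differentiable everywhere; the sign of
`(S W)' = S W' - f W` is used under the integral instead. -/
theorem mul_le_mul_of_primitive_of_le {f S W W' : ℝ → ℝ} {y z : ℝ} (hyz : y ≤ z)
    (hf : IntervalIntegrable f volume y z)
    (hS : ∀ t ∈ Set.Icc y z, S t = S y - ∫ s in y..t, f s)
    (hW : ∀ t ∈ Set.Icc y z, HasDerivAt W (W' t) t) (hW' : ContinuousOn W' (Set.Icc y z))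
    (hle : ∀ t ∈ Set.Icc y z, S t * W' t ≤ f t * W t) :
    S z * W z ≤ S y * W y := by
  rw [← sub_nonpos, mul_sub_mul_eq_integral_of_primitive hyz hf hS hW hW',
    intervalIntegral.integral_of_le hyz]
  refine setIntegral_nonpos measurableSet_Ioc fun t ht => ?_
  linarith [hle t ⟨ht.1.le, ht.2⟩]

theorem mul_le_mul_of_primitive_of_ge {f S W W' : ℝ → ℝ} {y z : ℝ} (hyz : y ≤ z)
    (hf : IntervalIntegrable f volume y z)
    (hS : ∀ t ∈ Set.Icc y z, S t = S y - ∫ s in y..t, f s)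
    (hW : ∀ t ∈ Set.Icc y z, HasDerivAt W (W' t) t) (hW' : ContinuousOn W' (Set.Icc y z))
    (hle : ∀ t ∈ Set.Icc y z, f t * W t ≤ S t * W' t) :
    S y * W y ≤ S z * W z := by
  rw [← sub_nonneg, mul_sub_mul_eq_integral_of_primitive hyz hf hS hW hW',
    intervalIntegral.integral_of_le hyz]
  refine setIntegral_nonneg measurableSet_Ioc fun t ht => ?_
  linarith [hle t ⟨ht.1.le, ht.2⟩]

/-! ### Elementary inequalities for powers and logarithms -/

/-- Above the threshold `t` one has `h ^ (p-1) ≤ t ^ (p-1)`, since `p ≤ 1`. With `t` a decaying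
weight in `x`, this trades `∫ h^p` for a moment of `h` plus the integral of the weight. -/
theorem rpow_le_mul_rpow_add_rpow {h t p : ℝ} (hh : 0 ≤ h) (ht : 0 < t) (hp : 0 < p)
    (hp1 : p ≤ 1) : h ^ p ≤ h * t ^ (p - 1) + t ^ p := by
  rcases le_total h t with hle | hle
  · have := Real.rpow_le_rpow hh hle hp.le
    have h2 : 0 ≤ h * t ^ (p - 1) := by positivity
    linarith
  · have hpos : 0 < h := ht.trans_le hle
    have h1 : h ^ p = h * h ^ (p - 1) := by
      rw [← Real.rpow_one_add' hh (by simpa using hp.ne')]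
      congr 1; ring
    have h2 : h ^ (p - 1) ≤ t ^ (p - 1) :=
      Real.rpow_le_rpow_of_nonpos ht hle (by linarith)
    have h3 : 0 ≤ t ^ p := by positivity
    rw [h1]
    nlinarith [mul_le_mul_of_nonneg_left h2 hh]

/-- The counterpart for exponents above `1`: integrated over a bounded interval, it turns mass of
`h` into a lower bound for `∫ h^β`. -/
theorem le_add_rpow_mul_rpow {h t β : ℝ} (hh : 0 ≤ h) (ht : 0 < t) (hβ : 1 < β) :
    h ≤ t + t ^ (1 - β) * h ^ β := by
  rcases le_total h t with hle | hle
  · have h2 : 0 ≤ t ^ (1 - β) * h ^ β := by positivity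
    linarith
  · have hpos : 0 < h := ht.trans_le hle
    have h1 : h = h ^ (1 - β) * h ^ β := by
      rw [← Real.rpow_add hpos]; simp
    have h2 : h ^ (1 - β) ≤ t ^ (1 - β) :=
      Real.rpow_le_rpow_of_nonpos ht hle (by linarith)
    have h3 : h ^ (1 - β) * h ^ β ≤ t ^ (1 - β) * h ^ β :=
      mul_le_mul_of_nonneg_right h2 (by positivity)
    linarith

theorem abs_rpow_sub_rpow_le {x y β : ℝ} (hx : 0 ≤ x) (hy : 0 ≤ y) (hβ : 1 < β) :
    |x ^ β - y ^ β| ≤ β * (x ^ (β - 1) + y ^ (β - 1)) * |x - y| := by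
  wlog hxy : y ≤ x generalizing x y
  · have := this hy hx (le_of_not_ge hxy)
    rwa [abs_sub_comm, abs_sub_comm x y, add_comm]
  have hx1 : 0 ≤ x ^ (β - 1) := by positivity
  have hy1 : 0 ≤ y ^ (β - 1) := by positivity
  have key : ‖x ^ β - y ^ β‖ ≤ β * x ^ (β - 1) * ‖x - y‖ := by
    apply Convex.norm_image_sub_le_of_norm_hasDerivWithin_le (s := Set.Icc 0 x)
      (f := fun t : ℝ => t ^ β) (f' := fun t => β * t ^ (β - 1))
    · intro t ht
      exact (Real.hasDerivAt_rpow_const (Or.inr hβ.le)).hasDerivWithinAt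
    · intro t ht
      have h0 : 0 ≤ t ^ (β - 1) := Real.rpow_nonneg ht.1 _
      rw [Real.norm_of_nonneg (by positivity)]
      have := Real.rpow_le_rpow ht.1 ht.2 (by linarith : 0 ≤ β - 1)
      nlinarith
    · exact convex_Icc _ _
    · exact ⟨hy, hxy⟩
    · exact ⟨hx, le_rfl⟩
  rw [Real.norm_eq_abs, Real.norm_eq_abs] at key
  refine key.trans ?_
  gcongr
  linarith

theorem abs_sub_rpow_le {x y p : ℝ} (hx : 0 ≤ x) (hy : 0 ≤ y) (hp : 0 < p) :
    |x - y| ^ p ≤ x ^ p + y ^ p := by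
  have hx1 : 0 ≤ x ^ p := by positivity
  have hy1 : 0 ≤ y ^ p := by positivity
  rcases le_total x y with h | h
  · have : |x - y| ≤ y := by rw [abs_le]; constructor <;> linarith
    linarith [Real.rpow_le_rpow (abs_nonneg _) this hp.le]
  · have : |x - y| ≤ x := by rw [abs_le]; constructor <;> linarith
    linarith [Real.rpow_le_rpow (abs_nonneg _) this hp.le]

theorem rpow_le_add_rpow_of_le {x p q r : ℝ} (hx : 0 ≤ x) (hp : 0 < p) (hpq : p ≤ q) (hqr : q ≤ r) :
    x ^ q ≤ x ^ p + x ^ r := by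
  have hp1 : 0 ≤ x ^ p := by positivity
  have hr1 : 0 ≤ x ^ r := by positivity
  rcases le_total x 1 with h | h
  · linarith [Real.rpow_le_rpow_of_exponent_ge_of_imp hx h hpq (by intro _ h; linarith)]
  · linarith [Real.rpow_le_rpow_of_exponent_le h hqr]

/-- If `|h - g| ≤ ε` then `h ^ β` is controlled by `g ^ β` and by `g + h`. -/
theorem rpow_le_of_abs_sub_le {g h ε β : ℝ} (hg : 0 ≤ g) (hh : 0 ≤ h) (hβ : 1 < β)
    (hle : |h - g| ≤ ε) : h ^ β ≤ 2 ^ β * (g ^ β + ε ^ (β - 1) * (g + h)) := by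
  have hε : 0 ≤ ε := (abs_nonneg _).trans hle
  have h1 : 0 ≤ g ^ β := by positivity
  have h2 : 0 ≤ ε ^ (β - 1) * (g + h) := by positivity
  have h3 : (0 : ℝ) < 2 ^ β := by positivity
  -- Either `h ≤ 2 g`, or `h / 2 ≤ h - g ≤ ε`; in the second case `β - 1` factors `h` are bounded by
  -- `2 ε` and one is kept for integrability.
  rcases le_total (h / 2) g with hc | hc
  · have : h ^ β ≤ (2 * g) ^ β := Real.rpow_le_rpow hh (by linarith) (by linarith)
    rw [Real.mul_rpow (by norm_num) hg] at this
    nlinarith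
  · have h4 : h ≤ 2 * ε := by
      have := (abs_le.1 hle).2
      linarith
    have h5 : h ^ β = h * h ^ (β - 1) := by
      rw [← Real.rpow_one_add' hh (by linarith)]
      congr 1; ring
    have h6 : h ^ (β - 1) ≤ (2 * ε) ^ (β - 1) := Real.rpow_le_rpow hh h4 (by linarith)
    rw [Real.mul_rpow (by norm_num) hε] at h6
    have h7 : (2 : ℝ) ^ (β - 1) ≤ 2 ^ β := Real.rpow_le_rpow_of_exponent_le (by norm_num) (by linarith)
    have h8 : 0 ≤ ε ^ (β - 1) := by positivity
    calc h ^ β = h * h ^ (β - 1) := h5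
      _ ≤ h * (2 ^ (β - 1) * ε ^ (β - 1)) := by gcongr
      _ ≤ h * (2 ^ β * ε ^ (β - 1)) := by gcongr
      _ = 2 ^ β * (ε ^ (β - 1) * h) := by ring
      _ ≤ 2 ^ β * (g ^ β + ε ^ (β - 1) * (g + h)) := by
        gcongr
        nlinarith [mul_nonneg h8 hg]

theorem abs_log_sub_log_le {x y c : ℝ} (hc : 0 < c) (hx : c ≤ x) (hy : c ≤ y) :
    |Real.log x - Real.log y| ≤ c⁻¹ * |x - y| := by
  wlog hxy : y ≤ x generalizing x y
  · rw [abs_sub_comm, abs_sub_comm x y]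
    exact this hy hx (le_of_not_ge hxy)
  have hy0 : 0 < y := hc.trans_le hy
  have hx0 : 0 < x := hc.trans_le hx
  rw [abs_of_nonneg (sub_nonneg.2 (Real.log_le_log hy0 hxy)), abs_of_nonneg (by linarith),
    ← Real.log_div hx0.ne' hy0.ne']
  have h1 := Real.log_le_sub_one_of_pos (div_pos hx0 hy0)
  have h2 : x / y - 1 = y⁻¹ * (x - y) := by field_simp
  rw [h2] at h1
  refine h1.trans ?_
  have : y⁻¹ ≤ c⁻¹ := inv_anti₀ hc hy
  exact mul_le_mul_of_nonneg_right this (by linarith)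

/-! ### Moments and densities -/

/-- Polynomial tails of order `k` give moments of every order `s < k`, uniformly. -/
theorem exists_moment_bound (C k s : ℝ) (hC : 0 ≤ C) (hs : 0 < s) (hsk : s < k) :
    ∃ B : ℝ, 0 ≤ B ∧ ∀ ν : Measure ℝ, ν Set.univ ≤ 1 →
      (∀ t : ℝ, 0 ≤ t → ν {x | t ≤ |x|} ≤ ENNReal.ofReal (C * (1 + t) ^ (-k))) →
      ∫⁻ x, ENNReal.ofReal ((1 + |x|) ^ s) ∂ν ≤ ENNReal.ofReal B := by
  have hint : IntegrableOn (fun t : ℝ => C * t ^ (-k + (s - 1))) (Set.Ioi 1) :=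
    (integrableOn_Ioi_rpow_of_lt (by linarith) one_pos).const_mul C
  have hint0 : IntegrableOn (fun t : ℝ => t ^ (s - 1)) (Set.Ioc 0 1) := by
    have := intervalIntegral.intervalIntegrable_rpow' (a := 0) (b := 1) (r := s - 1) (by linarith)
    rwa [intervalIntegrable_iff_integrableOn_Ioc_of_le zero_le_one] at this
  -- Layer-cake formula for `1 + |x|`, cut at `1`: total mass at most `1` handles small levels, the
  -- tail bound at `t - 1` the large ones, where `s < k` gives convergence.
  set J : ENNReal := ENNReal.ofReal s *
    ((∫⁻ t in Set.Ioc (0:ℝ) 1, ENNReal.ofReal (t ^ (s - 1))) +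
      ∫⁻ t in Set.Ioi (1:ℝ), ENNReal.ofReal (C * t ^ (-k + (s - 1)))) with hJ
  have hJt : J ≠ ⊤ := by
    refine ENNReal.mul_ne_top ENNReal.ofReal_ne_top (ENNReal.add_ne_top.2 ⟨?_, ?_⟩)
    · exact hint0.lintegral_lt_top.ne
    · exact hint.lintegral_lt_top.ne
  refine ⟨J.toReal, ENNReal.toReal_nonneg, fun ν hν htail => ?_⟩
  rw [ENNReal.ofReal_toReal hJt, lintegral_rpow_eq_lintegral_meas_le_mul _
    (ae_of_all _ fun x => by positivity) (by fun_prop) hs, hJ]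
  gcongr
  rw [← Set.Ioc_union_Ioi_eq_Ioi (zero_le_one' ℝ), lintegral_union measurableSet_Ioi
    (Set.Ioc_disjoint_Ioi le_rfl)]
  refine add_le_add (lintegral_mono fun t => ?_) (setLIntegral_mono' measurableSet_Ioi fun t ht => ?_)
  · calc _ ≤ 1 * ENNReal.ofReal (t ^ (s - 1)) := by
          gcongr
          exact (measure_mono (Set.subset_univ _)).trans hν
      _ = _ := one_mul _
  · have ht1 : (1:ℝ) < t := ht
    have h1 := htail (t - 1) (by linarith)
    have h2 : {x : ℝ | t - 1 ≤ |x|} = {x | t ≤ 1 + |x|} := by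
      ext x; simp only [Set.mem_ofPred_eq]; constructor <;> intro h <;> linarith
    rw [h2, show 1 + (t - 1) = t by ring] at h1
    calc _ ≤ ENNReal.ofReal (C * t ^ (-k)) * ENNReal.ofReal (t ^ (s - 1)) := by gcongr
      _ = _ := by
        rw [← ENNReal.ofReal_mul (by positivity), mul_assoc, ← Real.rpow_add (by linarith)]

theorem IsDensity.integrable {g : ℝ → ℝ} {ν : Measure ℝ} [IsFiniteMeasure ν]
    (h : IsDensity g ν) : Integrable g := by
  obtain ⟨hm, h0, rfl⟩ := h
  refine ⟨hm.aestronglyMeasurable, ?_⟩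
  rw [hasFiniteIntegral_iff_ofReal (ae_of_all _ h0)]
  have := measure_lt_top (volume.withDensity fun x => ENNReal.ofReal (g x)) Set.univ
  rwa [withDensity_apply _ MeasurableSet.univ, Measure.restrict_univ] at this

theorem IsDensity.measure_eq {g : ℝ → ℝ} {ν : Measure ℝ} (h : IsDensity g ν) {s : Set ℝ}
    (hs : MeasurableSet s) : ν s = ∫⁻ x in s, ENNReal.ofReal (g x) := by
  rw [h.2.2, withDensity_apply _ hs]

theorem IsDensity.measureReal_eq {g : ℝ → ℝ} {ν : Measure ℝ} (h : IsDensity g ν)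
    {s : Set ℝ} (hs : MeasurableSet s) : ν.real s = ∫ x in s, g x := by
  rw [measureReal_def, h.measure_eq hs, integral_eq_lintegral_of_nonneg_ae
    (ae_of_all _ h.2.1) h.1.aestronglyMeasurable.restrict]

theorem IsDensity.integral_eq_one {g : ℝ → ℝ} {ν : Measure ℝ} [IsProbabilityMeasure ν]
    (h : IsDensity g ν) : ∫ x, g x = 1 := by
  have := h.measureReal_eq MeasurableSet.univ
  simpa using this.symm

/-! ### Maxima of independent copies -/

theorem partialMax_le_iff {Ω : Type*} {X : ℕ → Ω → ℝ} {n : ℕ} (hn : 0 < n) (ω : Ω) (y : ℝ) :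
    partialMax X n ω ≤ y ↔ ∀ i : Fin n, X i ω ≤ y := by
  have : Nonempty (Fin n) := ⟨⟨0, hn⟩⟩
  exact ciSup_le_iff (Set.finite_range _).bddAbove

theorem exists_partialMax_eq {Ω : Type*} {X : ℕ → Ω → ℝ} {n : ℕ} (hn : 0 < n) (ω : Ω) :
    ∃ i : Fin n, X i ω = partialMax X n ω := by
  have : Nonempty (Fin n) := ⟨⟨0, hn⟩⟩
  exact exists_eq_ciSup_of_finite

section Max

variable {Ω : Type*} [MeasurableSpace Ω] {P : Measure Ω} {X : ℕ → Ω → ℝ}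

theorem measurable_partialMax (hXm : ∀ i, Measurable (X i)) (n : ℕ) :
    Measurable (partialMax X n) :=
  Measurable.iSup fun i : Fin n => hXm i

theorem measure_iInter_preimage [IsProbabilityMeasure P] (hXindep : iIndepFun X P) (hXid : ∀ i, IdentDistrib (X i) (X 0) P P) {n : ℕ}
    {B : Fin n → Set ℝ} (hB : ∀ i, MeasurableSet (B i)) :
    P (⋂ i : Fin n, X i ⁻¹' B i) = ∏ i : Fin n, P (X 0 ⁻¹' B i) := by
  have h : iIndepFun (fun i : Fin n => X i) P := hXindep.precomp Fin.val_injective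
  rw [h.meas_iInter (s := fun i : Fin n => X i ⁻¹' B i) fun i => ⟨B i, hB i, rfl⟩]
  exact Finset.prod_congr rfl fun i _ => (hXid i).measure_mem_eq (hB i)

theorem measureReal_partialMax_le [IsProbabilityMeasure P] (hXindep : iIndepFun X P) (hXid : ∀ i, IdentDistrib (X i) (X 0) P P) {n : ℕ} (hn : 0 < n)
    (y : ℝ) : P.real {ω | partialMax X n ω ≤ y} = P.real {ω | X 0 ω ≤ y} ^ n := by
  have h1 : {ω | partialMax X n ω ≤ y} = ⋂ i : Fin n, X i ⁻¹' Set.Iic y := by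
    ext ω; simp [partialMax_le_iff hn]
  rw [h1, measureReal_def, measure_iInter_preimage hXindep hXid fun _ => measurableSet_Iic]
  simp [measureReal_def, Set.preimage, ENNReal.toReal_pow]

/-- The maximum is attained by some variable, which then lies in `A` while the others are at most
`y`; a union bound over the `n` indices follows. This replaces the density formula `n F^(n-1) f`. -/
theorem measure_partialMax_mem_le [IsProbabilityMeasure P] (hXindep : iIndepFun X P) (hXid : ∀ i, IdentDistrib (X i) (X 0) P P) {n : ℕ} (hn : 0 < n)
    (y : ℝ) {A : Set ℝ} (hA : MeasurableSet A) :
    P {ω | partialMax X n ω ∈ A ∧ partialMax X n ω ≤ y} ≤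
      n * P {ω | X 0 ω ≤ y} ^ (n - 1) * P (X 0 ⁻¹' A) := by
  classical
  have hsub : {ω | partialMax X n ω ∈ A ∧ partialMax X n ω ≤ y} ⊆
      ⋃ i : Fin n, ⋂ j : Fin n, X j ⁻¹' (if j = i then A else Set.Iic y) := by
    rintro ω ⟨h1, h2⟩
    obtain ⟨i, hi⟩ := exists_partialMax_eq (X := X) hn ω
    refine Set.mem_iUnion.2 ⟨i, Set.mem_iInter.2 fun j => ?_⟩
    by_cases hj : j = i
    · subst hj
      simpa [hi] using h1
    · simpa [hj] using (partialMax_le_iff hn ω y).1 h2 j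
  refine (measure_mono hsub).trans ((measure_iUnion_fintype_le _ _).trans ?_)
  have hterm : ∀ i : Fin n,
      P (⋂ j : Fin n, X j ⁻¹' (if j = i then A else Set.Iic y)) =
        P {ω | X 0 ω ≤ y} ^ (n - 1) * P (X 0 ⁻¹' A) := by
    intro i
    rw [measure_iInter_preimage hXindep hXid (B := fun j => if j = i then A else Set.Iic y)
      fun j => by split_ifs; exacts [hA, measurableSet_Iic],
      ← Finset.mul_prod_erase _ _ (Finset.mem_univ i), Finset.prod_congr rfl (g := fun _ =>
        P {ω | X 0 ω ≤ y})]
    · simp [Finset.card_erase_of_mem, mul_comm]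
    · intro j hj
      simp [Finset.ne_of_mem_erase hj, Set.preimage]
  simp [hterm, mul_assoc]

end Max

/-! ### Distribution functions and quantiles -/

section Cdf

variable {Ω : Type*} [MeasurableSpace Ω] {P : Measure Ω} [IsProbabilityMeasure P] {Y : Ω → ℝ}
  {F f : ℝ → ℝ}

theorem eq_cdf_map (hY : Measurable Y) (hF : ∀ x, F x = P.real {ω | Y ω ≤ x}) :
    F = cdf (P.map Y) := by
  have := Measure.isProbabilityMeasure_map (μ := P) hY.aemeasurable
  ext x
  rw [cdf_eq_real, hF, map_measureReal_apply hY measurableSet_Iic]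
  rfl

theorem distribution_eq_add_integral (hY : Measurable Y) (hF : ∀ x, F x = P.real {ω | Y ω ≤ x})
    (hf : IsDensity f (P.map Y)) (y z : ℝ) : F z = F y + ∫ t in y..z, f t := by
  have := Measure.isProbabilityMeasure_map (μ := P) hY.aemeasurable
  have h : ∀ x, F x = ∫ t in Set.Iic x, f t := fun x => by
    rw [hF, ← hf.measureReal_eq measurableSet_Iic, map_measureReal_apply hY measurableSet_Iic]
    rfl
  rw [h, h, ← intervalIntegral.integral_Iic_sub_Iic hf.integrable.integrableOn
    hf.integrable.integrableOn]
  ring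

theorem distribution_continuous (hY : Measurable Y) (hF : ∀ x, F x = P.real {ω | Y ω ≤ x})
    (hf : IsDensity f (P.map Y)) : Continuous F := by
  have := Measure.isProbabilityMeasure_map (μ := P) hY.aemeasurable
  have h : F = fun z => F 0 + ∫ t in (0:ℝ)..z, f t :=
    funext fun z => distribution_eq_add_integral hY hF hf 0 z
  rw [h]
  exact continuous_const.add (intervalIntegral.continuous_primitive
    (fun _ _ => hf.integrable.intervalIntegrable) 0)

end Cdf

theorem apply_quantile {F : ℝ → ℝ} (hc : Continuous F)
    (h0 : Tendsto F atBot (𝓝 0)) (h1 : Tendsto F atTop (𝓝 1)) {p : ℝ} (hp0 : 0 < p) (hp1 : p < 1) :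
    F (quantile F p) = p := by
  have hne : {x | p < F x}.Nonempty := (h1.eventually (lt_mem_nhds hp1)).exists
  have hbdd : BddBelow {x | p < F x} := by
    obtain ⟨m, hm⟩ := eventually_atBot.1 (h0.eventually (gt_mem_nhds hp0))
    refine ⟨m, fun x hx => ?_⟩
    by_contra hlt
    exact lt_asymm hx (hm x (not_le.1 hlt).le)
  apply le_antisymm
  · by_contra hlt
    have hev : ∀ᶠ x in 𝓝 (quantile F p), p < F x :=
      hc.continuousAt.eventually (lt_mem_nhds (not_le.1 hlt))
    obtain ⟨l, hl, hl2⟩ := exists_Ioc_subset_of_mem_nhds hev (exists_lt _)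
    obtain ⟨x, hx1, hx2⟩ := exists_between hl
    exact absurd (csInf_le hbdd (hl2 ⟨hx1, hx2.le⟩)) (not_le.2 hx2)
  · have hcl := csInf_mem_closure hne hbdd
    exact closure_minimal (fun x (hx : p < F x) => hx.le)
      (isClosed_le continuous_const hc) hcl

/-! ### The Fréchet and Gumbel densities -/

theorem frechetDensity_nonneg {α : ℝ} (hα : 0 < α) (x : ℝ) : 0 ≤ frechetDensity α x := by
  unfold frechetDensity
  split_ifs with h
  · exact le_rfl
  · have : 0 < x := not_le.1 h
    positivity

theorem measurable_frechetDensity (α : ℝ) : Measurable (frechetDensity α) := by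
  unfold frechetDensity
  exact Measurable.ite measurableSet_Iic measurable_const (by fun_prop)

/-- The Fréchet distribution function. -/
noncomputable def frechetDistribution (α x : ℝ) : ℝ :=
  if x ≤ 0 then 0 else Real.exp (-x ^ (-α))

theorem hasDerivAt_frechetDistribution (α : ℝ) {x : ℝ} (hx : 0 < x) :
    HasDerivAt (frechetDistribution α) (frechetDensity α x) x := by
  have h1 : HasDerivAt (fun x : ℝ => Real.exp (-x ^ (-α)))
      (Real.exp (-x ^ (-α)) * (-(-α * x ^ (-α - 1)))) x :=
    ((Real.hasDerivAt_rpow_const (Or.inl hx.ne')).neg).exp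
  have h2 : frechetDensity α x = Real.exp (-x ^ (-α)) * (-(-α * x ^ (-α - 1))) := by
    rw [frechetDensity, if_neg (not_le.2 hx), show -(α + 1) = -α - 1 by ring]
    ring
  rw [h2]
  refine h1.congr_of_eventuallyEq ?_
  filter_upwards [lt_mem_nhds hx] with y hy
  rw [frechetDistribution, if_neg (not_le.2 hy)]

theorem continuousWithinAt_frechetDistribution_zero {α : ℝ} (hα : 0 < α) :
    ContinuousWithinAt (frechetDistribution α) (Set.Ici 0) 0 := by
  rw [← continuousWithinAt_Ioi_iff_Ici, ContinuousWithinAt]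
  have h0 : frechetDistribution α 0 = 0 := by simp [frechetDistribution]
  rw [h0]
  have h1 : Tendsto (fun x : ℝ => Real.exp (-x ^ (-α))) (𝓝[>] 0) (𝓝 0) :=
    Real.tendsto_exp_neg_atTop_nhds_zero.comp (tendsto_rpow_neg_nhdsGT_zero (by linarith))
  refine h1.congr' ?_
  filter_upwards [self_mem_nhdsWithin] with y hy
  rw [frechetDistribution, if_neg (not_le.2 hy)]

theorem tendsto_frechetDistribution_atTop {α : ℝ} (hα : 0 < α) :
    Tendsto (frechetDistribution α) atTop (𝓝 1) := by
  have h1 : Tendsto (fun x : ℝ => Real.exp (-x ^ (-α))) atTop (𝓝 1) := by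
    have := ((tendsto_rpow_neg_atTop hα).neg).rexp
    simpa using this
  refine h1.congr' ?_
  filter_upwards [eventually_gt_atTop 0] with y hy
  rw [frechetDistribution, if_neg (not_le.2 hy)]

theorem frechetDensity_of_nonpos (α : ℝ) {x : ℝ} (hx : x ≤ 0) : frechetDensity α x = 0 := by
  rw [frechetDensity, if_pos hx]

theorem integrable_of_integrableOn_Ioi {h : ℝ → ℝ} (h0 : ∀ x ≤ 0, h x = 0)
    (hi : IntegrableOn h (Set.Ioi 0)) : Integrable h := by
  rw [← integrableOn_univ, ← Set.Iic_union_Ioi (a := (0:ℝ))]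
  refine IntegrableOn.union ?_ hi
  exact integrableOn_zero.congr_fun (fun x hx => (h0 x hx).symm) measurableSet_Iic

theorem integrable_frechetDensity {α : ℝ} (hα : 0 < α) : Integrable (frechetDensity α) :=
  integrable_of_integrableOn_Ioi (fun _ => frechetDensity_of_nonpos α)
    (integrableOn_Ioi_deriv_of_nonneg (continuousWithinAt_frechetDistribution_zero hα)
      (fun _ hx => hasDerivAt_frechetDistribution α hx) (fun x _ => frechetDensity_nonneg hα x)
      (tendsto_frechetDistribution_atTop hα))

/-- With `b n = 0`, the point `1` is mapped to the quantile by the normalization; the value `e⁻¹`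
there is what separates `g` from `gₙ`. -/
theorem integral_Iic_one_frechetDensity {α : ℝ} (hα : 0 < α) :
    ∫ x in Set.Iic 1, frechetDensity α x = Real.exp (-1) := by
  have hi := integrable_frechetDensity hα
  rw [← Set.Iic_union_Ioc_eq_Iic (zero_le_one' ℝ), setIntegral_union
    (Set.Iic_disjoint_Ioc le_rfl) measurableSet_Ioc hi.integrableOn hi.integrableOn,
    setIntegral_eq_zero_of_forall_eq_zero (t := Set.Iic 0)
      (fun x hx => frechetDensity_of_nonpos α hx), zero_add,
    ← intervalIntegral.integral_of_le zero_le_one,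
    intervalIntegral.integral_eq_sub_of_hasDerivAt_of_le zero_le_one
      (f := frechetDistribution α) ?_ (fun x hx => hasDerivAt_frechetDistribution α hx.1)
      hi.intervalIntegrable]
  · simp [frechetDistribution]
  · intro x hx
    rcases hx.1.eq_or_lt with h | h
    · rw [← h]
      exact (continuousWithinAt_frechetDistribution_zero hα).mono Set.Icc_subset_Ici_self
    · exact (hasDerivAt_frechetDistribution α h).continuousAt.continuousWithinAt

/-- On `(0, 1]` the power is at most the density plus `1`. At infinity it is at most a multiple of
`x ^ (-(α+1) p)`, which is where `p > 1/(1+α)` is needed. -/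
theorem integrable_frechetDensity_rpow {α p : ℝ} (hα : 0 < α) (hp : 0 < p) (hp1 : p ≤ 1)
    (hpα : (1 + α)⁻¹ < p) : Integrable fun x => frechetDensity α x ^ p := by
  refine integrable_of_integrableOn_Ioi
    (fun x hx => by rw [frechetDensity_of_nonpos α hx, Real.zero_rpow hp.ne']) ?_
  have hm : AEStronglyMeasurable (fun x => frechetDensity α x ^ p) volume :=
    ((measurable_frechetDensity α).pow_const p).aestronglyMeasurable
  rw [← Set.Ioc_union_Ioi_eq_Ioi (zero_le_one' ℝ)]
  refine IntegrableOn.union ?_ ?_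
  · have h1 : IntegrableOn (fun x => frechetDensity α x + 1) (Set.Ioc 0 1) :=
      (integrable_frechetDensity hα).integrableOn.add (integrableOn_const (by simp))
    refine h1.mono' hm.restrict (ae_of_all _ fun x => ?_)
    have h0 := frechetDensity_nonneg hα x
    rw [Real.norm_of_nonneg (by positivity)]
    simpa using rpow_le_mul_rpow_add_rpow h0 one_pos hp hp1
  · have hlt : -(α + 1) * p < -1 := by
      rw [inv_lt_iff_one_lt_mul₀ (by linarith)] at hpα
      linarith
    have h1 : IntegrableOn (fun x : ℝ => α ^ p * x ^ (-(α + 1) * p)) (Set.Ioi 1) :=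
      (integrableOn_Ioi_rpow_of_lt hlt one_pos).const_mul _
    refine h1.mono' hm.restrict ?_
    filter_upwards [ae_restrict_mem measurableSet_Ioi] with x hx
    have hx0 : (0:ℝ) < x := one_pos.trans hx
    have h0 := frechetDensity_nonneg hα x
    rw [Real.norm_of_nonneg (by positivity), Real.rpow_mul hx0.le,
      ← Real.mul_rpow hα.le (by positivity)]
    refine Real.rpow_le_rpow h0 ?_ hp.le
    rw [frechetDensity, if_neg (not_le.2 hx0)]
    refine mul_le_of_le_one_right (by positivity) (Real.exp_le_one_iff.2 ?_)
    have : 0 ≤ x ^ (-α) := by positivity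
    linarith

theorem gumbelDensity_nonneg (x : ℝ) : 0 ≤ gumbelDensity x := by
  unfold gumbelDensity; positivity

theorem measurable_gumbelDensity : Measurable gumbelDensity := by
  unfold gumbelDensity; fun_prop

/-- On the right `e^(-p x)` dominates. On the left, after `t = -x` and `p ≤ 1`, the dominating
function `e^t e^(-p e^t)` has an explicit primitive. -/
theorem integrable_gumbelDensity_rpow {p : ℝ} (hp : 0 < p) (hp1 : p ≤ 1) :
    Integrable fun x => gumbelDensity x ^ p := by
  have hm : AEStronglyMeasurable (fun x => gumbelDensity x ^ p) volume :=
    (measurable_gumbelDensity.pow_const p).aestronglyMeasurable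
  have hpow : ∀ x, gumbelDensity x ^ p = Real.exp (-(p * x)) * Real.exp (-(p * Real.exp (-x))) := by
    intro x
    rw [gumbelDensity, ← Real.exp_add, ← Real.exp_add, ← Real.exp_mul]
    congr 1; ring
  rw [← integrableOn_univ, ← Set.Iic_union_Ioi (a := (0:ℝ))]
  refine IntegrableOn.union ?_ ?_
  · have hφ : IntegrableOn (fun t : ℝ => Real.exp t * Real.exp (-(p * Real.exp t)))
        (Set.Ioi 0) := by
      refine integrableOn_Ioi_deriv_of_nonneg' (l := 0)
        (g := fun t => -(p⁻¹) * Real.exp (-(p * Real.exp t))) (fun t _ => ?_)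
        (fun t _ => by positivity) ?_
      · have h1 : HasDerivAt (fun t => Real.exp (-(p * Real.exp t)))
            (Real.exp (-(p * Real.exp t)) * (-(p * Real.exp t))) t :=
          (((Real.hasDerivAt_exp t).const_mul p).neg).exp
        refine (h1.const_mul (-(p⁻¹))).congr_deriv ?_
        field_simp
      · have h1 : Tendsto (fun t => Real.exp (-(p * Real.exp t))) atTop (𝓝 0) :=
          Real.tendsto_exp_neg_atTop_nhds_zero.comp (Real.tendsto_exp_atTop.const_mul_atTop hp)
        simpa using h1.const_mul (-(p⁻¹))
    have hφ' := ((Measure.measurePreserving_neg (volume : Measure ℝ)).integrableOn_comp_preimage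
      (MeasurableEquiv.neg ℝ).measurableEmbedding).2 ((integrableOn_Ici_iff_integrableOn_Ioi (by finiteness)).2 hφ)
    rw [Set.neg_preimage, Set.neg_Ici, neg_zero] at hφ'
    refine hφ'.mono' hm.restrict ?_
    filter_upwards [ae_restrict_mem measurableSet_Iic] with x hx
    rw [hpow, Real.norm_of_nonneg (by positivity)]
    change _ ≤ Real.exp (-x) * Real.exp (-(p * Real.exp (-x)))
    gcongr
    have : x ≤ 0 := hx
    nlinarith
  · refine (integrableOn_exp_mul_Ioi (a := -p) (by linarith) 0).mono' hm.restrict ?_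
    filter_upwards with x
    rw [hpow, Real.norm_of_nonneg (by positivity), neg_mul]
    refine mul_le_of_le_one_right (by positivity) (Real.exp_le_one_iff.2 ?_)
    have : 0 < Real.exp (-x) := Real.exp_pos _
    nlinarith

theorem integrable_gumbelDensity : Integrable gumbelDensity := by
  simpa using integrable_gumbelDensity_rpow one_pos le_rfl

theorem integral_Iic_zero_gumbelDensity :
    ∫ x in Set.Iic 0, gumbelDensity x = Real.exp (-1) := by
  have hd : ∀ x, HasDerivAt (fun x => Real.exp (-Real.exp (-x))) (gumbelDensity x) x := by
    intro x
    have h1 : HasDerivAt (fun x => Real.exp (-Real.exp (-x)))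
        (Real.exp (-Real.exp (-x)) * (-(Real.exp (-x) * -1))) x :=
      (((hasDerivAt_neg x).exp).neg).exp
    convert h1 using 1
    rw [gumbelDensity]; ring
  have hlim : Tendsto (fun x => Real.exp (-Real.exp (-x))) atBot (𝓝 0) :=
    Real.tendsto_exp_neg_atTop_nhds_zero.comp
      (Real.tendsto_exp_atTop.comp tendsto_neg_atBot_atTop)
  rw [integral_Iic_of_hasDerivAt_of_tendsto' (fun x _ => hd x)
    integrable_gumbelDensity.integrableOn hlim]
  simp

/-! ### Decay of the survival function under von Mises bounds -/

/-- Regular variation estimate under the Fréchet von Mises bound `k ≤ x f(x) / S(x)`. -/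
theorem survival_mul_rpow_le {S f : ℝ → ℝ} {k y z : ℝ} (hy : 0 < y) (hyz : y ≤ z)
    (hf : Integrable f) (hS : ∀ s t, S t = S s - ∫ v in s..t, f v)
    (hle : ∀ t ∈ Set.Icc y z, k * S t ≤ t * f t) :
    S z * z ^ k ≤ S y * y ^ k := by
  refine mul_le_mul_of_primitive_of_le (W := fun t => t ^ k) (W' := fun t => k * t ^ (k - 1)) hyz
    hf.intervalIntegrable (fun t _ => hS y t)
    (fun t ht => Real.hasDerivAt_rpow_const (Or.inl (hy.trans_le ht.1).ne')) ?_ ?_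
  · intro t ht
    exact (continuousAt_const.mul (Real.continuousAt_rpow_const _ _
      (Or.inl (hy.trans_le ht.1).ne'))).continuousWithinAt
  · intro t ht
    have ht0 : 0 < t := hy.trans_le ht.1
    have h1 : t ^ k = t * t ^ (k - 1) := by
      rw [mul_comm, ← Real.rpow_add_one ht0.ne']; congr 1; ring
    have h2 : 0 < t ^ (k - 1) := by positivity
    have := mul_le_mul_of_nonneg_right (hle t ht) h2.le
    rw [h1]
    linarith

section Gumbel

variable {S T f : ℝ → ℝ} {δ : ℝ} {D : Set ℝ}

/-- `S T^(-(1-δ))` is decreasing if `f T ≥ (1-δ) S²`. -/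
theorem survival_mul_tail_rpow_antitone (hD : D.OrdConnected)
    (hf : Integrable f) (hS : ∀ s t, S t = S s - ∫ v in s..t, f v) (hSc : Continuous S)
    (hT : ∀ t ∈ D, 0 < T t) (hTd : ∀ t ∈ D, HasDerivAt T (-S t) t)
    (hle : ∀ t ∈ D, (1 - δ) * S t ^ 2 ≤ f t * T t) {y z : ℝ} (hy : y ∈ D) (hz : z ∈ D)
    (hyz : y ≤ z) :
    S z * T z ^ (-(1 - δ)) ≤ S y * T y ^ (-(1 - δ)) := by
  have hsub : Set.Icc y z ⊆ D := hD.out hy hz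
  refine mul_le_mul_of_primitive_of_le (W := fun t => T t ^ (-(1 - δ)))
    (W' := fun t => -S t * (-(1 - δ)) * T t ^ (-(1 - δ) - 1)) hyz
    hf.intervalIntegrable (fun t _ => hS y t)
    (fun t ht => (hTd t (hsub ht)).rpow_const (Or.inl (hT t (hsub ht)).ne')) ?_ ?_
  · intro t ht
    exact ((hSc.continuousAt.neg.mul continuousAt_const).mul
      ((hTd t (hsub ht)).continuousAt.rpow_const
        (Or.inl (hT t (hsub ht)).ne'))).continuousWithinAt
  · intro t ht
    have ht0 := hT t (hsub ht)
    have h1 : T t ^ (-(1 - δ)) = T t * T t ^ (-(1 - δ) - 1) := by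
      rw [mul_comm, ← Real.rpow_add_one ht0.ne']; congr 1; ring
    have h2 : 0 < T t ^ (-(1 - δ) - 1) := by positivity
    have := mul_le_mul_of_nonneg_right (hle t (hsub ht)) h2.le
    rw [h1]
    linarith

/-- `S T^(-(1+δ))` is increasing if `f T ≤ (1+δ) S²`. -/
theorem survival_mul_tail_rpow_monotone (hD : D.OrdConnected)
    (hf : Integrable f) (hS : ∀ s t, S t = S s - ∫ v in s..t, f v) (hSc : Continuous S)
    (hT : ∀ t ∈ D, 0 < T t) (hTd : ∀ t ∈ D, HasDerivAt T (-S t) t)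
    (hle : ∀ t ∈ D, f t * T t ≤ (1 + δ) * S t ^ 2) {y z : ℝ} (hy : y ∈ D) (hz : z ∈ D)
    (hyz : y ≤ z) :
    S y * T y ^ (-(1 + δ)) ≤ S z * T z ^ (-(1 + δ)) := by
  have hsub : Set.Icc y z ⊆ D := hD.out hy hz
  refine mul_le_mul_of_primitive_of_ge (W := fun t => T t ^ (-(1 + δ)))
    (W' := fun t => -S t * (-(1 + δ)) * T t ^ (-(1 + δ) - 1)) hyz
    hf.intervalIntegrable (fun t _ => hS y t)
    (fun t ht => (hTd t (hsub ht)).rpow_const (Or.inl (hT t (hsub ht)).ne')) ?_ ?_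
  · intro t ht
    exact ((hSc.continuousAt.neg.mul continuousAt_const).mul
      ((hTd t (hsub ht)).continuousAt.rpow_const
        (Or.inl (hT t (hsub ht)).ne'))).continuousWithinAt
  · intro t ht
    have ht0 := hT t (hsub ht)
    have h1 : T t ^ (-(1 + δ)) = T t * T t ^ (-(1 + δ) - 1) := by
      rw [mul_comm, ← Real.rpow_add_one ht0.ne']; congr 1; ring
    have h2 : 0 < T t ^ (-(1 + δ) - 1) := by positivity
    have := mul_le_mul_of_nonneg_right (hle t (hsub ht)) h2.le
    rw [h1]
    linarith

/-- The derivative of `T^(-δ)` is `δ S T^(-(1+δ))`, an increasing function, so it is at least its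
value at `y`; hence the rate `S / T` at the left end. -/
theorem one_add_mul_le_tail_ratio_rpow_neg (hD : D.OrdConnected) (hδ : 0 < δ)
    (hf : Integrable f) (hS : ∀ s t, S t = S s - ∫ v in s..t, f v) (hSc : Continuous S)
    (hT : ∀ t ∈ D, 0 < T t) (hTd : ∀ t ∈ D, HasDerivAt T (-S t) t)
    (hle : ∀ t ∈ D, f t * T t ≤ (1 + δ) * S t ^ 2) {y z : ℝ} (hy : y ∈ D) (hz : z ∈ D)
    (hyz : y ≤ z) :
    1 + δ * ((z - y) * (S y / T y)) ≤ (T z / T y) ^ (-δ) := by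
  have hsub : Set.Icc y z ⊆ D := hD.out hy hz
  have hd : ∀ t ∈ Set.Icc y z, HasDerivAt (fun t => T t ^ (-δ)) (-S t * (-δ) * T t ^ (-δ - 1)) t :=
    fun t ht => (hTd t (hsub ht)).rpow_const (Or.inl (hT t (hsub ht)).ne')
  have key := (convex_Icc y z).mul_sub_le_image_sub_of_le_deriv (f := fun t => T t ^ (-δ))
    (fun t ht => (hd t ht).continuousAt.continuousWithinAt)
    (fun t ht => (hd t (interior_subset ht)).differentiableAt.differentiableWithinAt)
    (C := δ * (S y * T y ^ (-(1 + δ)))) (fun t ht => by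
      have ht' := interior_subset ht
      rw [(hd t ht').deriv]
      have := survival_mul_tail_rpow_monotone hD hf hS hSc hT hTd hle hy (hsub ht') ht'.1
      have h3 := mul_le_mul_of_nonneg_left this hδ.le
      rw [show -δ - 1 = -(1 + δ) by ring]
      linarith) y ⟨le_rfl, hyz⟩ z ⟨hyz, le_rfl⟩ hyz
  have hTy := hT y hy
  have hTz := hT z hz
  have h4 : T y ^ (-(1 + δ)) = T y ^ (-δ) / T y := by
    rw [← Real.rpow_sub_one hTy.ne']; congr 1; ring
  rw [Real.div_rpow hTz.le hTy.le, le_div_iff₀ (by positivity)]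
  rw [h4] at key
  have h5 : δ * (S y * (T y ^ (-δ) / T y)) * (z - y) =
    δ * ((z - y) * (S y / T y)) * T y ^ (-δ) := by ring
  linarith

/-- The derivative of `-T^δ` is `δ S T^(-(1-δ))`, a decreasing function, so it is at least its value
at `z`; hence the rate at the right end. -/
theorem one_add_mul_le_tail_ratio_rpow (hD : D.OrdConnected) (hδ : 0 < δ)
    (hf : Integrable f) (hS : ∀ s t, S t = S s - ∫ v in s..t, f v) (hSc : Continuous S)
    (hT : ∀ t ∈ D, 0 < T t) (hTd : ∀ t ∈ D, HasDerivAt T (-S t) t)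
    (hle : ∀ t ∈ D, (1 - δ) * S t ^ 2 ≤ f t * T t) {y z : ℝ} (hy : y ∈ D) (hz : z ∈ D)
    (hyz : y ≤ z) :
    1 + δ * ((z - y) * (S z / T z)) ≤ (T y / T z) ^ δ := by
  have hsub : Set.Icc y z ⊆ D := hD.out hy hz
  have hd : ∀ t ∈ Set.Icc y z, HasDerivAt (fun t => -T t ^ δ) (-(-S t * δ * T t ^ (δ - 1))) t :=
    fun t ht => ((hTd t (hsub ht)).rpow_const (Or.inl (hT t (hsub ht)).ne')).neg
  have key := (convex_Icc y z).mul_sub_le_image_sub_of_le_deriv (f := fun t => -T t ^ δ)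
    (fun t ht => (hd t ht).continuousAt.continuousWithinAt)
    (fun t ht => (hd t (interior_subset ht)).differentiableAt.differentiableWithinAt)
    (C := δ * (S z * T z ^ (-(1 - δ)))) (fun t ht => by
      have ht' := interior_subset ht
      rw [(hd t ht').deriv]
      have := survival_mul_tail_rpow_antitone hD hf hS hSc hT hTd hle (hsub ht') hz ht'.2
      have h3 := mul_le_mul_of_nonneg_left this hδ.le
      rw [show δ - 1 = -(1 - δ) by ring]
      linarith) y ⟨le_rfl, hyz⟩ z ⟨hyz, le_rfl⟩ hyz
  have hTy := hT y hy
  have hTz := hT z hz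
  have h4 : T z ^ (-(1 - δ)) = T z ^ δ / T z := by
    rw [← Real.rpow_sub_one hTz.ne']; congr 1; ring
  rw [Real.div_rpow hTy.le hTz.le, le_div_iff₀ (by positivity)]
  rw [h4] at key
  have h5 : δ * (S z * (T z ^ δ / T z)) * (z - y) =
    δ * ((z - y) * (S z / T z)) * T z ^ δ := by ring
  linarith

/-- Both tails: with `u = T / S`, the ratio `S y / S z` is at least a power of
`1 + δ (z - y) / u`, where `u` may be evaluated at either end. -/
theorem rpow_mul_survival_le (hD : D.OrdConnected) (hδ : 0 < δ) (hδ1 : δ < 1)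
    (hf : Integrable f) (hS : ∀ s t, S t = S s - ∫ v in s..t, f v) (hSc : Continuous S)
    (hS0 : ∀ t ∈ D, 0 < S t)
    (hT : ∀ t ∈ D, 0 < T t) (hTd : ∀ t ∈ D, HasDerivAt T (-S t) t)
    (hle : ∀ t ∈ D, (1 - δ) * S t ^ 2 ≤ f t * T t) (hge : ∀ t ∈ D, f t * T t ≤ (1 + δ) * S t ^ 2)
    {y z w : ℝ} (hy : y ∈ D) (hz : z ∈ D) (hyz : y ≤ z) (hw : w = y ∨ w = z) :
    (1 + δ * ((z - y) * (S w / T w))) ^ ((1 - δ) / δ) * S z ≤ S y := by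
  have hTy := hT y hy
  have hTz := hT z hz
  have hwD : w ∈ D := by rcases hw with rfl | rfl <;> assumption
  have h1 : 1 + δ * ((z - y) * (S w / T w)) ≤ (T y / T z) ^ δ := by
    rcases hw with rfl | rfl
    · have := one_add_mul_le_tail_ratio_rpow_neg hD hδ hf hS hSc hT hTd hge hy hz hyz
      rwa [Real.rpow_neg (by positivity), ← Real.inv_rpow (by positivity), inv_div] at this
    · exact one_add_mul_le_tail_ratio_rpow hD hδ hf hS hSc hT hTd hle hy hz hyz
  have h0 : 0 ≤ 1 + δ * ((z - y) * (S w / T w)) := by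
    have := div_pos (hS0 w hwD) (hT w hwD)
    have := sub_nonneg.2 hyz
    positivity
  have h2 : (1 + δ * ((z - y) * (S w / T w))) ^ ((1 - δ) / δ) ≤ (T y / T z) ^ (1 - δ) := by
    refine (Real.rpow_le_rpow h0 h1 (div_nonneg (by linarith) hδ.le)).trans_eq ?_
    rw [← Real.rpow_mul (by positivity)]
    congr 1; field_simp
  -- This passes from `T` back to `S`: `(T y / T z)^(1-δ) ≤ S y / S z`.
  have h3 := survival_mul_tail_rpow_antitone hD hf hS hSc hT hTd hle hy hz hyz
  rw [Real.rpow_neg hTz.le, Real.rpow_neg hTy.le, ← div_eq_mul_inv, ← div_eq_mul_inv,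
    div_le_div_iff₀ (by positivity) (by positivity)] at h3
  refine (mul_le_mul_of_nonneg_right h2 (hS0 z hz).le).trans ?_
  rw [Real.div_rpow hTy.le hTz.le, div_mul_eq_mul_div, div_le_iff₀ (by positivity)]
  linarith

end Gumbel

/-! ### Tail control of the normalized maximum -/

/-- Polynomial control of order `k`, uniform in `n`, of both tails of the normalized maximum,
the left one only above a fixed level. -/
def TailControl (F : ℝ → ℝ) (a b : ℕ → ℝ) (k : ℝ) : Prop :=
  ∃ y₀ C c : ℝ, F y₀ < 1 ∧ 0 ≤ C ∧ 0 < c ∧ ∀ᶠ n : ℕ in atTop, c / n ≤ a n ∧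
    (∀ x, 1 ≤ x → n * (1 - F (a n * x + b n)) ≤ C * (1 + x) ^ (-k)) ∧
    (∀ x, 1 ≤ x → y₀ < a n * (-x) + b n →
      (1 + x) ^ k ≤ C * (n * (1 - F (a n * (-x) + b n))))

/-- A continuous distribution function with density `f`. -/
structure IsDistributionWithDensity (F f : ℝ → ℝ) : Prop where
  continuous : Continuous F
  monotone : Monotone F
  tendsto_atBot : Tendsto F atBot (𝓝 0)
  tendsto_atTop : Tendsto F atTop (𝓝 1)
  integrable : Integrable f
  eq_add_integral : ∀ y z, F z = F y + ∫ t in y..z, f t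

namespace IsDistributionWithDensity

variable {F f : ℝ → ℝ}

theorem le_one (h : IsDistributionWithDensity F f) (x : ℝ) : F x ≤ 1 := h.monotone.ge_of_tendsto h.tendsto_atTop x

theorem nonneg (h : IsDistributionWithDensity F f) (x : ℝ) : 0 ≤ F x := h.monotone.le_of_tendsto h.tendsto_atBot x

theorem survival_eq (h : IsDistributionWithDensity F f) (s t : ℝ) : 1 - F t = 1 - F s - ∫ v in s..t, f v := by
  rw [h.eq_add_integral s t]; ring

theorem apply_quantile_one_sub (h : IsDistributionWithDensity F f) {n : ℕ} (hn : 1 < n) :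
    F (quantile F (1 - 1 / (n : ℝ))) = 1 - 1 / (n : ℝ) := by
  have h1 : (1:ℝ) < n := by exact_mod_cast hn
  have h2 : 1 / (n:ℝ) < 1 := by rw [div_lt_one (by linarith)]; exact h1
  have h3 : 0 < 1 / (n:ℝ) := by positivity
  exact apply_quantile h.continuous h.tendsto_atBot h.tendsto_atTop (by linarith) (by linarith)

theorem eventually_lt_quantile (h : IsDistributionWithDensity F f) {y : ℝ} (hy : F y < 1) :
    ∀ᶠ n : ℕ in atTop, y < quantile F (1 - 1 / (n : ℝ)) := by
  have h1 : Tendsto (fun n : ℕ => 1 - 1 / (n : ℝ)) atTop (𝓝 1) := by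
    simpa using tendsto_one_div_atTop_nhds_zero_nat.const_sub (1:ℝ)
  filter_upwards [h1.eventually (lt_mem_nhds hy), eventually_gt_atTop 1] with n hn hn1
  by_contra hle
  have := h.monotone (not_lt.1 hle)
  rw [h.apply_quantile_one_sub hn1] at this
  linarith

theorem mul_survival_quantile (h : IsDistributionWithDensity F f) {n : ℕ} (hn : 1 < n) :
    n * (1 - F (quantile F (1 - 1 / (n : ℝ)))) = 1 := by
  have h1 : (n:ℝ) ≠ 0 := by positivity
  rw [h.apply_quantile_one_sub hn]
  field_simp
  ring

theorem tailControl_of_frechet (h : IsDistributionWithDensity F f) {α k : ℝ} (hα : 0 < α) (hvm : VonMisesFrechet F f α)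
    (hk : 0 < k) (hkα : k < α) {a b : ℕ → ℝ} (ha : ∀ n, a n = quantile F (1 - 1 / (n : ℝ)))
    (hb : ∀ n, b n = 0) : TailControl F a b k := by
  have hpos : ∀ x, F x < 1 := by
    intro x
    by_contra hx
    have h1 : F x = 1 := le_antisymm (h.le_one x) (not_lt.1 hx)
    -- Once `F` reaches `1`, division by zero makes the quotient `0`, contradicting the limit `α >
    -- 0`.
    have h2 : (fun x => x * f x / (1 - F x)) =ᶠ[atTop] fun _ => 0 := by
      filter_upwards [eventually_ge_atTop x] with t ht
      have : F t = 1 := le_antisymm (h.le_one t) (h1 ▸ h.monotone ht)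
      simp [this]
    exact hα.ne' (tendsto_nhds_unique hvm (tendsto_const_nhds.congr' h2.symm))
  obtain ⟨y₁, hy₁⟩ := eventually_atTop.1 (hvm.eventually (lt_mem_nhds hkα))
  set y₀ := max y₁ 1 with hy₀
  have hbound : ∀ t, y₀ ≤ t → k * (1 - F t) ≤ t * f t := by
    intro t ht
    have h1 := hy₁ t ((le_max_left _ _).trans ht)
    rw [lt_div_iff₀ (by linarith [hpos t])] at h1
    exact h1.le
  -- `2 ^ k` comes from `1 + x ≤ 2 x` for `x ≥ 1`, and `c = 1` suffices because `a n > y₀ ≥ 1`.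
  refine ⟨y₀, 2 ^ k, 1, hpos _, by positivity, one_pos, ?_⟩
  filter_upwards [h.eventually_lt_quantile (hpos y₀), eventually_gt_atTop 1] with n hn hn1
  rw [← ha] at hn
  have hn0 : (1:ℝ) < n := by exact_mod_cast hn1
  have hy0 : 1 ≤ y₀ := le_max_right _ _
  have hS := h.mul_survival_quantile hn1
  rw [← ha] at hS
  refine ⟨?_, fun x hx => ?_, fun x hx hlt => ?_⟩
  · have : 1 / (n:ℝ) ≤ 1 := by rw [div_le_one (by linarith)]; exact hn0.le
    linarith
  · have ha0 : 0 < a n := by linarith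
    have hle : a n ≤ a n * x := le_mul_of_one_le_right ha0.le hx
    have key := survival_mul_rpow_le (S := fun t => 1 - F t) ha0 hle h.integrable h.survival_eq
      (k := k) fun t ht => hbound t (hn.le.trans ht.1)
    have hx0 : 0 < x := by linarith
    rw [hb, add_zero]
    rw [Real.mul_rpow ha0.le hx0.le] at key
    have hak : 0 < a n ^ k := by positivity
    have hxk : 0 < x ^ k := by positivity
    have h2 : (1 - F (a n * x)) * x ^ k ≤ 1 - F (a n) := by
      refine le_of_mul_le_mul_right ?_ hak
      linarith
    have h3 : n * (1 - F (a n * x)) * x ^ k ≤ 1 := by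
      have := mul_le_mul_of_nonneg_left h2 (by linarith : (0:ℝ) ≤ n)
      linarith
    have h4 : (1 + x) ^ k ≤ 2 ^ k * x ^ k := by
      rw [← Real.mul_rpow (by norm_num) hx0.le]
      exact Real.rpow_le_rpow (by linarith) (by linarith) hk.le
    rw [Real.rpow_neg (by linarith), ← div_eq_mul_inv, le_div_iff₀ (by positivity)]
    have h5 : 0 ≤ n * (1 - F (a n * x)) := mul_nonneg (by linarith) (by linarith [hpos (a n * x)])
    have h6 : (0:ℝ) < 2 ^ k := by positivity
    calc n * (1 - F (a n * x)) * (1 + x) ^ k ≤ n * (1 - F (a n * x)) * (2 ^ k * x ^ k) := by gcongr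
      _ = 2 ^ k * (n * (1 - F (a n * x)) * x ^ k) := by ring
      _ ≤ 2 ^ k * 1 := by gcongr
      _ = 2 ^ k := mul_one _
  -- The left tail is vacuous: `a n * (-x)` is negative while `y₀ ≥ 1`.
  · exfalso
    rw [hb] at hlt
    nlinarith

theorem lt_one_of_lt_rightEnd (h : IsDistributionWithDensity F f) {x : ℝ} (hx : (x : EReal) < rightEnd F) : F x < 1 := by
  obtain ⟨_, ⟨y, hy, rfl⟩, hxy⟩ := lt_sSup_iff.1 hx
  exact (h.monotone (EReal.coe_lt_coe_iff.1 hxy).le).trans_lt hy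

theorem lt_rightEnd_iff (h : IsDistributionWithDensity F f) {x : ℝ} : (x : EReal) < rightEnd F ↔ F x < 1 := by
  refine ⟨h.lt_one_of_lt_rightEnd, fun hx => ?_⟩
  obtain ⟨u, hu, hu2⟩ := exists_Ico_subset_of_mem_nhds
    (h.continuous.continuousAt.eventually (gt_mem_nhds hx)) (exists_gt x)
  obtain ⟨y, hy1, hy2⟩ := exists_between hu
  exact (EReal.coe_lt_coe_iff.2 hy1).trans_le (le_sSup ⟨y, hu2 ⟨hy1.le, hy2⟩, rfl⟩)

/-- A property holding near the right extremity holds on an interval below it. -/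
theorem exists_forall_of_eventually (h : IsDistributionWithDensity F f) {q : ℝ → Prop}
    (hq : ∀ᶠ x in comap (fun x : ℝ => (x : EReal)) (𝓝[<] (rightEnd F)), q x) :
    ∃ l : ℝ, F l < 1 ∧ ∀ x, l < x → F x < 1 → q x := by
  obtain ⟨s, hs, hsq⟩ := hq
  obtain ⟨x₀, hx₀⟩ := (h.tendsto_atBot.eventually (gt_mem_nhds one_pos)).exists
  have hx₀r := h.lt_rightEnd_iff.2 hx₀
  obtain ⟨l, hl, hls⟩ := (mem_nhdsLT_iff_exists_Ioo_subset' hx₀r).1 hs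
  obtain ⟨y, hly, hyr⟩ := EReal.lt_iff_exists_real_btwn.1 hl
  refine ⟨y, h.lt_rightEnd_iff.1 hyr, fun x hx hx1 => hsq ?_⟩
  exact hls ⟨hly.trans (EReal.coe_lt_coe_iff.2 hx), h.lt_rightEnd_iff.2 hx1⟩

theorem tailIntegral_eq (h : IsDistributionWithDensity F f) (x : ℝ) : tailIntegral F x = ∫ t in {t : ℝ | x < t ∧ F t < 1}, (1 - F t) := by
  simp only [tailIntegral, h.lt_rightEnd_iff]

theorem tailIntegral_nonneg (h : IsDistributionWithDensity F f) (x : ℝ) : 0 ≤ tailIntegral F x :=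
  integral_nonneg fun t => by simpa using h.le_one t

theorem measurableSet_tail (h : IsDistributionWithDensity F f) (x : ℝ) : MeasurableSet {t : ℝ | x < t ∧ F t < 1} :=
  measurableSet_Ioi.inter (h.continuous.measurable measurableSet_Iio)

theorem tailIntegral_eq_sub (h : IsDistributionWithDensity F f) {y z : ℝ} (hyz : y ≤ z) (hz : F z < 1) (hT : 0 < tailIntegral F y) :
    tailIntegral F z = tailIntegral F y - ∫ t in y..z, (1 - F t) := by
  -- Positivity of the tail integral encodes integrability, as a divergent one would have the
  -- default value `0`.
  have hint : IntegrableOn (fun t => 1 - F t) {t : ℝ | y < t ∧ F t < 1} := by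
    by_contra hni
    rw [h.tailIntegral_eq, integral_undef hni] at hT
    exact lt_irrefl _ hT
  have hset : {t : ℝ | y < t ∧ F t < 1} = Set.Ioc y z ∪ {t : ℝ | z < t ∧ F t < 1} := by
    ext t
    simp only [Set.mem_ofPred_eq, Set.mem_union, Set.mem_Ioc]
    constructor
    · rintro ⟨h1, h2⟩
      rcases le_or_gt t z with h3 | h3
      · exact Or.inl ⟨h1, h3⟩
      · exact Or.inr ⟨h3, h2⟩
    · rintro (⟨h1, h2⟩ | ⟨h1, h2⟩)
      · exact ⟨h1, (h.monotone h2).trans_lt hz⟩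
      · exact ⟨hyz.trans_lt h1, h2⟩
  have hdisj : Disjoint (Set.Ioc y z) {t : ℝ | z < t ∧ F t < 1} :=
    Set.disjoint_left.2 fun t ht ht' => absurd ht.2 (not_le.2 ht'.1)
  rw [h.tailIntegral_eq, h.tailIntegral_eq, hset, setIntegral_union hdisj (h.measurableSet_tail z)
    (hint.mono_set (hset ▸ Set.subset_union_left))
    (hint.mono_set (hset ▸ Set.subset_union_right)), intervalIntegral.integral_of_le hyz]
  ring

theorem hasDerivAt_tailIntegral (h : IsDistributionWithDensity F f) {l t : ℝ} (hT : ∀ x, l < x → F x < 1 → 0 < tailIntegral F x)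
    (hlt : l < t) (ht : F t < 1) : HasDerivAt (tailIntegral F) (-(1 - F t)) t := by
  obtain ⟨y, hly, hyt⟩ := exists_between hlt
  have hcont : Continuous fun t => 1 - F t := continuous_const.sub h.continuous
  have h1 : HasDerivAt (fun z => tailIntegral F y - ∫ t in y..z, (1 - F t)) (-(1 - F t)) t :=
    (intervalIntegral.integral_hasDerivAt_right (hcont.intervalIntegrable _ _)
      (hcont.stronglyMeasurableAtFilter _ _) hcont.continuousAt).const_sub _
  refine h1.congr_of_eventuallyEq ?_
  filter_upwards [lt_mem_nhds hyt, h.continuous.continuousAt.eventually (gt_mem_nhds ht)] with z hz hz1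
  exact h.tailIntegral_eq_sub hz.le hz1 (hT y hly ((h.monotone hyt.le).trans_lt ht))

/-- Both comparisons are anchored at `b n`, where `n S = 1` and `T / S = a n`. It is the left end of
the interval for the right tail and the right end for the left tail, whence the need for estimates
with the rate at either end. -/
theorem tailControl_of_gumbel (h : IsDistributionWithDensity F f) {k : ℝ} (hvm : VonMisesGumbel F f) (hk : 1 ≤ k) {a b : ℕ → ℝ}
    (hb : ∀ n, b n = quantile F (1 - 1 / (n : ℝ))) (ha : ∀ n, a n = auxFun F (b n)) :
    TailControl F a b k := by
  -- Chosen so that the exponent `(1-δ)/δ` equals `k`.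
  set δ : ℝ := 1 / (1 + k) with hδdef
  have hδ : 0 < δ := by positivity
  have hδ1 : δ < 1 := by rw [hδdef, div_lt_one (by linarith)]; linarith
  have hδk : (1 - δ) / δ = k := by rw [hδdef]; field_simp; ring
  obtain ⟨l, hl, hlq⟩ := h.exists_forall_of_eventually
    (hvm.eventually (Ioo_mem_nhds (by linarith : 1 - δ < 1) (by linarith : (1:ℝ) < 1 + δ)))
  set D : Set ℝ := {x | l < x ∧ F x < 1} with hDdef
  have hDo : D.OrdConnected := ⟨fun y hy z hz t ht =>
    ⟨hy.1.trans_le ht.1, (h.monotone ht.2).trans_lt hz.2⟩⟩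
  have hT : ∀ x ∈ D, 0 < tailIntegral F x := by
    intro x hx
    have h1 := (hlq x hx.1 hx.2).1
    refine (h.tailIntegral_nonneg x).lt_of_ne fun h0 => ?_
    rw [← h0] at h1
    simp at h1
    linarith
  have hS0 : ∀ x ∈ D, 0 < 1 - F x := fun x hx => by linarith [hx.2]
  have hTd : ∀ x ∈ D, HasDerivAt (tailIntegral F) (-(1 - F x)) x := fun x hx =>
    h.hasDerivAt_tailIntegral (fun x hx hx1 => hT x ⟨hx, hx1⟩) hx.1 hx.2
  have hle : ∀ t ∈ D, (1 - δ) * (1 - F t) ^ 2 ≤ f t * tailIntegral F t := fun t ht => by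
    have h1 := (hlq t ht.1 ht.2).1
    have := hS0 t ht
    rw [lt_div_iff₀ (by positivity)] at h1
    exact h1.le
  have hge : ∀ t ∈ D, f t * tailIntegral F t ≤ (1 + δ) * (1 - F t) ^ 2 := fun t ht => by
    have h1 := (hlq t ht.1 ht.2).2
    have := hS0 t ht
    rw [div_lt_iff₀ (by positivity)] at h1
    exact h1.le
  have hcont : Continuous fun t => 1 - F t := continuous_const.sub h.continuous
  have hmain : ∀ {y z w : ℝ}, y ∈ D → z ∈ D → y ≤ z → (w = y ∨ w = z) →
      (1 + δ * ((z - y) / auxFun F w)) ^ k * (1 - F z) ≤ 1 - F y := by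
    intro y z w hy hz hyz hw
    have := rpow_mul_survival_le (S := fun t => 1 - F t) hDo hδ hδ1 h.integrable h.survival_eq
      hcont hS0 hT hTd hle hge hy hz hyz hw
    rw [hδk] at this
    rwa [auxFun, div_div_eq_mul_div, mul_div_assoc]
  -- The second point keeps `b n - y₀` above the fixed gap `y₂ - y₀`, as required for the lower
  -- bound on `a n`.
  have hright : ∃ y₀ y₂, y₀ < y₂ ∧ y₀ ∈ D ∧ F y₂ < 1 := by
    have hlr := h.lt_rightEnd_iff.2 hl
    obtain ⟨y₂, h1, h2⟩ := EReal.lt_iff_exists_real_btwn.1 hlr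
    obtain ⟨y₀, h3, h4⟩ := exists_between (EReal.coe_lt_coe_iff.1 h1)
    have h5 := h.lt_rightEnd_iff.1 h2
    exact ⟨y₀, y₂, h4, ⟨h3, (h.monotone h4.le).trans_lt h5⟩, h5⟩
  obtain ⟨y₀, y₂, hy02, hy0D, hy2⟩ := hright
  refine ⟨y₀, δ ^ (-k), δ * (y₂ - y₀), hy0D.2, by positivity,
    mul_pos hδ (by linarith), ?_⟩
  filter_upwards [h.eventually_lt_quantile hy2, eventually_gt_atTop 1] with n hn hn1
  rw [← hb] at hn
  have hn0 : (0:ℝ) < n := by positivity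
  have hS := h.mul_survival_quantile hn1
  rw [← hb] at hS
  have hbD : b n ∈ D := by
    refine ⟨hy0D.1.trans (hy02.trans hn), ?_⟩
    by_contra hcon
    have : F (b n) = 1 := le_antisymm (h.le_one _) (not_lt.1 hcon)
    rw [this] at hS
    simp at hS
  have ha0 : 0 < a n := by
    rw [ha, auxFun]
    exact div_pos (hT _ hbD) (hS0 _ hbD)
  have hpow : ∀ x : ℝ, 1 ≤ x → (1 + x) ^ k ≤ δ ^ (-k) * (1 + δ * x) ^ k := by
    intro x hx
    have : 0 < 1 + δ * x := by positivity
    rw [Real.rpow_neg hδ.le, ← Real.inv_rpow hδ.le, ← Real.mul_rpow (by positivity) this.le]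
    refine Real.rpow_le_rpow (by linarith) ?_ (by linarith)
    rw [inv_mul_eq_div, le_div_iff₀ hδ]
    nlinarith
  refine ⟨?_, fun x hx => ?_, fun x hx hlt => ?_⟩
  -- Between `y₀` and `b n` the survival function drops by a factor at most `n`, so `δ (b n - y₀) /
  -- a n ≤ n`; `k ≥ 1` allows dropping the power.
  · have h1 := hmain hy0D hbD (hy02.trans hn).le (Or.inr rfl)
    rw [← ha] at h1
    have h2 : 0 < (b n - y₀) / a n := div_pos (by linarith) ha0
    have h3 : δ * ((b n - y₀) / a n) ≤ (1 + δ * ((b n - y₀) / a n)) ^ k := by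
      have h4 : 1 ≤ 1 + δ * ((b n - y₀) / a n) := by
        have := mul_pos hδ h2
        linarith
      have := Real.rpow_le_rpow_of_exponent_le h4 hk
      rw [Real.rpow_one] at this
      linarith
    have h5 : δ * ((b n - y₀) / a n) ≤ n := by
      have h6 := mul_le_mul_of_nonneg_left h1 hn0.le
      have h7 : 1 - F y₀ ≤ 1 := by linarith [h.nonneg y₀]
      have h8 : n * (1 - F y₀) ≤ n := by nlinarith
      have h9 : n * ((1 + δ * ((b n - y₀) / a n)) ^ k * (1 - F (b n))) =
        (1 + δ * ((b n - y₀) / a n)) ^ k := by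
        rw [mul_left_comm, hS, mul_one]
      linarith
    rw [div_le_iff₀ hn0]
    rw [← mul_div_assoc, div_le_iff₀ ha0] at h5
    nlinarith
  · by_cases hx1 : F (a n * x + b n) < 1
    · have hle' : b n ≤ a n * x + b n := by nlinarith
      have h1 := hmain hbD ⟨hbD.1.trans_le hle', hx1⟩ hle' (Or.inl rfl)
      rw [← ha, add_sub_cancel_right, mul_div_cancel_left₀ _ ha0.ne'] at h1
      rw [Real.rpow_neg (by linarith : 0 ≤ 1 + x), ← div_eq_mul_inv, le_div_iff₀ (by positivity)]
      have h2 : (1 + δ * x) ^ k * (n * (1 - F (a n * x + b n))) ≤ 1 := by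
        have := mul_le_mul_of_nonneg_left h1 hn0.le
        linarith
      have h3 : 0 ≤ n * (1 - F (a n * x + b n)) := mul_nonneg hn0.le (by linarith)
      calc n * (1 - F (a n * x + b n)) * (1 + x) ^ k
          ≤ n * (1 - F (a n * x + b n)) * (δ ^ (-k) * (1 + δ * x) ^ k) := by
            gcongr; exact hpow x hx
        _ = δ ^ (-k) * ((1 + δ * x) ^ k * (n * (1 - F (a n * x + b n)))) := by ring
        _ ≤ δ ^ (-k) * 1 := by gcongr
        _ = δ ^ (-k) := mul_one _
    · have : F (a n * x + b n) = 1 := le_antisymm (h.le_one _) (not_lt.1 hx1)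
      rw [this, sub_self, mul_zero]
      have : 0 < 1 + x := by linarith
      positivity
  · have hle' : a n * (-x) + b n ≤ b n := by nlinarith
    have h1 := hmain ⟨hy0D.1.trans hlt, (h.monotone hle').trans_lt hbD.2⟩ hbD hle' (Or.inr rfl)
    rw [← ha, show b n - (a n * (-x) + b n) = a n * x by ring,
      mul_div_cancel_left₀ _ ha0.ne'] at h1
    have h2 : (1 + δ * x) ^ k ≤ n * (1 - F (a n * (-x) + b n)) := by
      have h3 := mul_le_mul_of_nonneg_left h1 hn0.le
      have h4 : n * ((1 + δ * x) ^ k * (1 - F (b n))) = (1 + δ * x) ^ k := by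
        rw [mul_left_comm, hS, mul_one]
      linarith
    refine (hpow x hx).trans ?_
    gcongr

end IsDistributionWithDensity

/-! ### The law of the normalized maximum -/

section Law

variable {Ω : Type*} [MeasurableSpace Ω] {P : Measure Ω} [IsProbabilityMeasure P]
  {X : ℕ → Ω → ℝ} {F f : ℝ → ℝ}

theorem isDistributionWithDensity {Y : Ω → ℝ} (hY : Measurable Y)
    (hF : ∀ x, F x = P.real {ω | Y ω ≤ x}) (hf : IsDensity f (P.map Y)) :
    IsDistributionWithDensity F f := by
  have := Measure.isProbabilityMeasure_map (μ := P) hY.aemeasurable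
  have hcdf := eq_cdf_map hY hF
  refine ⟨distribution_continuous hY hF hf, ?_, ?_, ?_, hf.integrable,
    distribution_eq_add_integral hY hF hf⟩
  · rw [hcdf]; exact monotone_cdf _
  · rw [hcdf]; exact tendsto_cdf_atBot _
  · rw [hcdf]; exact tendsto_cdf_atTop _

theorem measurable_normalizedMax (hXm : ∀ i, Measurable (X i)) (n : ℕ) (a b : ℝ) :
    Measurable fun ω => (partialMax X n ω - b) / a :=
  ((measurable_partialMax hXm n).sub_const b).div_const a

theorem normalizedMax_law_Iic (hXm : ∀ i, Measurable (X i)) (hXindep : iIndepFun X P)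
    (hXid : ∀ i, IdentDistrib (X i) (X 0) P P) (hF : ∀ x, F x = P.real {ω | X 0 ω ≤ x})
    {n : ℕ} (hn : 0 < n) {a : ℝ} (ha : 0 < a) (b x : ℝ) :
    (P.map fun ω => (partialMax X n ω - b) / a).real (Set.Iic x) = F (a * x + b) ^ n := by
  rw [map_measureReal_apply (measurable_normalizedMax hXm n a b) measurableSet_Iic, hF,
    ← measureReal_partialMax_le hXindep hXid hn]
  congr 1
  ext ω
  simp only [Set.mem_preimage, Set.mem_Iic, Set.mem_ofPred_eq]
  rw [div_le_iff₀ ha, sub_le_iff_le_add, mul_comm x a]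

theorem normalizedMax_law_inter_le (hXm : ∀ i, Measurable (X i)) (hXindep : iIndepFun X P)
    (hXid : ∀ i, IdentDistrib (X i) (X 0) P P) (hF : ∀ x, F x = P.real {ω | X 0 ω ≤ x})
    (hf : IsDensity f (P.map (X 0))) {n : ℕ} (hn : 0 < n) {a : ℝ} (ha : 0 < a) (b y : ℝ)
    {s : Set ℝ} (hs : MeasurableSet s) :
    (P.map fun ω => (partialMax X n ω - b) / a) (s ∩ {x | a * x + b ≤ y}) ≤
      ENNReal.ofReal (n * F y ^ (n - 1)) * ∫⁻ x in s, ENNReal.ofReal (a * f (a * x + b)) := by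
  have hm : MeasurableSet {x : ℝ | a * x + b ≤ y} :=
    measurableSet_le (by fun_prop) measurable_const
  rw [Measure.map_apply (measurable_normalizedMax hXm n a b) (hs.inter hm)]
  have hinv : ∀ z, a * ((z - b) / a) + b = z := fun z => by field_simp; ring
  have himg : (fun x => a * x + b) '' s = (fun z => (z - b) / a) ⁻¹' s := by
    ext z
    constructor
    · rintro ⟨x, hx, rfl⟩
      have : (a * x + b - b) / a = x := by field_simp; ring
      rwa [Set.mem_preimage, this]
    · intro hz
      exact ⟨_, hz, hinv z⟩
  have hA : MeasurableSet ((fun x => a * x + b) '' s) := by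
    rw [himg]
    exact (by fun_prop : Measurable fun z : ℝ => (z - b) / a) hs
  have hset : (fun ω => (partialMax X n ω - b) / a) ⁻¹' (s ∩ {x | a * x + b ≤ y}) =
      {ω | partialMax X n ω ∈ (fun x => a * x + b) '' s ∧ partialMax X n ω ≤ y} := by
    ext ω
    rw [himg]
    simp only [Set.mem_preimage, Set.mem_inter_iff, Set.mem_ofPred_eq, hinv]
  rw [hset]
  refine (measure_partialMax_mem_le hXindep hXid hn y hA).trans_eq ?_
  have h1 : P (X 0 ⁻¹' ((fun x => a * x + b) '' s)) =
      ∫⁻ x in s, ENNReal.ofReal (a * f (a * x + b)) := by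
    rw [← Measure.map_apply (hXm 0) hA, hf.measure_eq hA,
      lintegral_image_eq_lintegral_abs_deriv_mul hs (f := fun x => a * x + b) (f' := fun _ => a)]
    · refine lintegral_congr fun x => ?_
      rw [abs_of_pos ha, ENNReal.ofReal_mul ha.le]
    · intro x _
      simpa using (((hasDerivAt_id x).const_mul a).add_const b).hasDerivWithinAt
    · intro x _ z _ hxz
      simpa [ha.ne'] using hxz
  rw [h1, hF, ENNReal.ofReal_mul (by positivity), ENNReal.ofReal_pow (by positivity),
    ENNReal.ofReal_natCast, ofReal_measureReal]

end Law

/-! ### Uniform integral bounds -/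

section Bounds

variable {μ : Measure ℝ} {F f h : ℝ → ℝ} {a b y₀ C k : ℝ} {n : ℕ}

/-- From `p ≤ e^(-(1-p))` and `e^(-v) ≤ 1/v`; on the left tail, growth of `n (1 - F)` thus becomes
decay of `F^n`. -/
theorem pow_le_inv_mul_one_sub {p : ℝ} (hp : 0 ≤ p) (hp1 : p < 1) {n : ℕ} (hn : 0 < n) :
    p ^ n ≤ (n * (1 - p))⁻¹ := by
  have hv : 0 < n * (1 - p) := mul_pos (by exact_mod_cast hn) (by linarith)
  calc p ^ n ≤ Real.exp (-(1 - p)) ^ n := by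
        gcongr
        have := Real.add_one_le_exp (-(1 - p))
        linarith
    _ = (Real.exp (n * (1 - p)))⁻¹ := by
        rw [← Real.exp_nat_mul, ← Real.exp_neg]; congr 1; ring
    _ ≤ (n * (1 - p))⁻¹ := by
        gcongr
        have := Real.add_one_le_exp (n * (1 - p))
        linarith

/-- On the right, Bernoulli gives `1 - F^n ≤ n (1 - F)`; on the left, `F^n ≤ 1 / (n (1 - F))`. The
term `2 ^ k` absorbs `t < 1`. -/
theorem restrict_tail_le [IsProbabilityMeasure μ] (hd : IsDensity h μ) (hF : IsDistributionWithDensity F f)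
    (hcdf : ∀ x, μ.real (Set.Iic x) = F (a * x + b) ^ n) (hn : 0 < n) (ha : 0 < a) (hC : 0 ≤ C)
    (hk : 0 < k)
    (hr : ∀ x, 1 ≤ x → n * (1 - F (a * x + b)) ≤ C * (1 + x) ^ (-k))
    (hl : ∀ x, 1 ≤ x → y₀ < a * (-x) + b →
      (1 + x) ^ k ≤ C * (n * (1 - F (a * (-x) + b)))) {t : ℝ} (ht : 0 ≤ t) :
    μ.restrict {x | y₀ < a * x + b} {x | t ≤ |x|} ≤
      ENNReal.ofReal ((2 * C + 2 ^ k) * (1 + t) ^ (-k)) := by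
  have hpos : 0 < (1 + t) ^ (-k) := by positivity
  have hm : MeasurableSet {x : ℝ | t ≤ |x|} := measurableSet_le measurable_const (by fun_prop)
  rw [Measure.restrict_apply hm]
  rcases lt_or_ge t 1 with h1 | h1
  · refine prob_le_one.trans ?_
    rw [ENNReal.one_le_ofReal]
    have h2 : (1 + t) ^ k ≤ 2 ^ k := Real.rpow_le_rpow (by linarith) (by linarith) hk.le
    have h3 : 1 ≤ 2 ^ k * (1 + t) ^ (-k) := by
      rw [Real.rpow_neg (by linarith), ← div_eq_mul_inv, one_le_div (by positivity)]
      exact h2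
    have h4 : 0 ≤ 2 * C * (1 + t) ^ (-k) := by positivity
    linarith
  · have hac : μ ≪ volume := by
      rw [hd.2.2]; exact withDensity_absolutelyContinuous _ _
    have hright : μ (Set.Ici t) ≤ ENNReal.ofReal (C * (1 + t) ^ (-k)) := by
      have h2 : μ (Set.Ici t) = μ (Set.Iic t)ᶜ := by
        rw [Set.compl_Iic]
        exact measure_congr (hac.ae_eq Ioi_ae_eq_Ici.symm)
      rw [h2, ← ofReal_measureReal, probReal_compl_eq_one_sub measurableSet_Iic, hcdf]
      apply ENNReal.ofReal_le_ofReal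
      refine le_trans ?_ (hr t h1)
      have := one_add_mul_le_pow (a := F (a * t + b) - 1)
        (by linarith [hF.nonneg (a * t + b)]) n
      rw [add_sub_cancel] at this
      linarith
    have hleft : μ ({x | y₀ < a * x + b} ∩ Set.Iic (-t)) ≤ ENNReal.ofReal (C * (1 + t) ^ (-k)) := by
      by_cases hy : y₀ < a * (-t) + b
      · have h2 := hl t h1 hy
        have h2pos : 0 < (1 + t) ^ k := by positivity
        have hlt : F (a * (-t) + b) < 1 := by
          by_contra hcon
          have : F (a * (-t) + b) = 1 := le_antisymm (hF.le_one _) (not_lt.1 hcon)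
          rw [this] at h2
          simp at h2
          linarith
        refine (measure_mono Set.inter_subset_right).trans ?_
        rw [← ofReal_measureReal, hcdf]
        apply ENNReal.ofReal_le_ofReal
        refine (pow_le_inv_mul_one_sub (hF.nonneg _) hlt hn).trans ?_
        have hv : 0 < n * (1 - F (a * (-t) + b)) :=
          mul_pos (by exact_mod_cast hn) (by linarith)
        rw [Real.rpow_neg (by linarith), inv_eq_one_div, ← div_eq_mul_inv,
          div_le_div_iff₀ hv h2pos]
        linarith
      · have : {x | y₀ < a * x + b} ∩ Set.Iic (-t) = ∅ := by
          ext x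
          simp only [Set.mem_inter_iff, Set.mem_ofPred_eq, Set.mem_Iic, Set.mem_empty_iff_false,
            iff_false, not_and, not_le]
          intro hx
          by_contra hcon
          have := mul_le_mul_of_nonneg_left (not_lt.1 hcon) ha.le
          linarith [not_lt.1 hy]
        rw [this]
        simp
    have hsub : {x | t ≤ |x|} ∩ {x | y₀ < a * x + b} ⊆
        Set.Ici t ∪ ({x | y₀ < a * x + b} ∩ Set.Iic (-t)) := by
      rintro x ⟨hx, hx2⟩
      rcases le_abs.1 (show t ≤ |x| from hx) with hx3 | hx3
      · exact Or.inl hx3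
      · exact Or.inr ⟨hx2, show x ≤ -t by linarith⟩
    calc _ ≤ μ (Set.Ici t) + μ ({x | y₀ < a * x + b} ∩ Set.Iic (-t)) :=
          (measure_mono hsub).trans (measure_union_le _ _)
      _ ≤ ENNReal.ofReal (C * (1 + t) ^ (-k)) + ENNReal.ofReal (C * (1 + t) ^ (-k)) :=
          add_le_add hright hleft
      _ = ENNReal.ofReal (2 * C * (1 + t) ^ (-k)) := by
          rw [← ENNReal.ofReal_add (by positivity) (by positivity)]
          congr 1; ring
      _ ≤ _ := by
          apply ENNReal.ofReal_le_ofReal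
          have : 0 < (2:ℝ) ^ k := by positivity
          nlinarith

theorem density_le_of_law_le (hd : IsDensity h μ) (hfm : Measurable f) {K : ℝ} (hK : 0 ≤ K)
    (ha : 0 < a)
    (hle : ∀ s, MeasurableSet s → μ (s ∩ {x | a * x + b ≤ y₀}) ≤
      ENNReal.ofReal K * ∫⁻ x in s, ENNReal.ofReal (a * f (a * x + b))) (hf0 : ∀ x, 0 ≤ f x) :
    ∀ᵐ x, a * x + b ≤ y₀ → h x ≤ K * (a * f (a * x + b)) := by
  have hm : MeasurableSet {x : ℝ | a * x + b ≤ y₀} :=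
    measurableSet_le (by fun_prop) measurable_const
  have key : ({x : ℝ | a * x + b ≤ y₀}.indicator fun x => ENNReal.ofReal (h x)) ≤ᵐ[volume]
      fun x => ENNReal.ofReal K * ENNReal.ofReal (a * f (a * x + b)) := by
    refine ae_le_of_forall_setLIntegral_le_of_sigmaFinite
      (hd.1.ennreal_ofReal.indicator hm) fun s hs _ => ?_
    rw [setLIntegral_indicator hm, Set.inter_comm, ← hd.measure_eq (hs.inter hm),
      lintegral_const_mul _ (by fun_prop)]
    exact hle s hs
  filter_upwards [key] with x hx hxy
  rw [Set.indicator_of_mem (show x ∈ {x : ℝ | a * x + b ≤ y₀} from hxy),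
    ← ENNReal.ofReal_mul hK] at hx
  refine (ENNReal.ofReal_le_ofReal_iff ?_).1 hx
  exact mul_nonneg hK (mul_nonneg ha.le (hf0 _))

theorem lintegral_rpow_comp_affine {p : ℝ} (ha : 0 < a) {K : ℝ} (hK : 0 ≤ K)
    (hf0 : ∀ x, 0 ≤ f x) (hfp : Integrable fun x => f x ^ p) :
    ∫⁻ x, ENNReal.ofReal ((K * (a * f (a * x + b))) ^ p) =
      ENNReal.ofReal (K ^ p * a ^ (p - 1) * ∫ x, f x ^ p) := by
  have h1 : ∀ x, (K * (a * f (a * x + b))) ^ p = K ^ p * a ^ p * f (a * x + b) ^ p := by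
    intro x
    rw [Real.mul_rpow hK (mul_nonneg ha.le (hf0 _)), Real.mul_rpow ha.le (hf0 _), mul_assoc]
  have hi : Integrable fun x => f (a * x + b) ^ p :=
    (hfp.comp_add_right b).comp_mul_left' (R := a) ha.ne'
  have h2 : ∫ x, f (a * x + b) ^ p = a⁻¹ * ∫ x, f x ^ p := by
    rw [Measure.integral_comp_mul_left (fun x => f (x + b) ^ p) a,
      integral_add_right_eq_self (fun x => f x ^ p) b, abs_of_pos (by positivity), smul_eq_mul]
  rw [← ofReal_integral_eq_lintegral_ofReal]
  · simp_rw [h1]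
    rw [integral_const_mul, h2, Real.rpow_sub_one ha.ne']
    congr 1; ring
  · simp_rw [h1]
    exact hi.const_mul _
  · exact ae_of_all _ fun x => Real.rpow_nonneg (mul_nonneg hK (mul_nonneg ha.le (hf0 _))) _

/-- Uniform bound for the integral of a power `p < 1` of a density with controlled tails, which is
dominated by a multiple of `f` below the level `y₀`. -/
theorem exists_lintegral_rpow_bound {p : ℝ} (C k : ℝ) (hp : 0 < p) (hp1 : p < 1) (hC : 0 ≤ C)
    (hpk : 1 < p * (1 + k)) :
    ∃ B : ℝ, 0 ≤ B ∧ ∀ (μ : Measure ℝ) [IsProbabilityMeasure μ] (h f : ℝ → ℝ) (a b y₀ K : ℝ),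
      IsDensity h μ → Measurable f → (∀ x, 0 ≤ f x) → Integrable (fun x => f x ^ p) →
      0 < a → 0 ≤ K →
      (∀ t, 0 ≤ t → μ.restrict {x | y₀ < a * x + b} {x | t ≤ |x|} ≤
        ENNReal.ofReal (C * (1 + t) ^ (-k))) →
      (∀ s, MeasurableSet s → μ (s ∩ {x | a * x + b ≤ y₀}) ≤
        ENNReal.ofReal K * ∫⁻ x in s, ENNReal.ofReal (a * f (a * x + b))) →
      ∫⁻ x, ENNReal.ofReal (h x ^ p) ≤
        ENNReal.ofReal (B + K ^ p * a ^ (p - 1) * ∫ x, f x ^ p) := by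
  -- For the weight `(1 + |x|)^(-q)`, integrability of its `p`-th power needs `q p > 1`, and the
  -- moment needs `q (1-p) < k`. Such a `q` exists exactly because `p (1 + k) > 1`.
  have hq : p⁻¹ < k / (1 - p) := by
    rw [inv_eq_one_div, div_lt_div_iff₀ hp (by linarith)]
    linarith
  obtain ⟨q, hq1, hq2⟩ := exists_between hq
  have hq0 : 0 < q := (inv_pos.2 hp).trans hq1
  have hqp : 1 < q * p := by rwa [inv_lt_iff_one_lt_mul₀ hp] at hq1
  rw [lt_div_iff₀ (by linarith)] at hq2
  obtain ⟨B, hB0, hB⟩ := exists_moment_bound C k (q * (1 - p)) hC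
    (mul_pos hq0 (by linarith)) hq2
  have hint : Integrable fun x : ℝ => (1 + |x|) ^ (-(q * p)) := by
    have := integrable_one_add_norm (E := ℝ) (μ := volume) (r := q * p) (by simpa using hqp)
    simpa using this
  have hI0 : 0 ≤ ∫ x : ℝ, (1 + |x|) ^ (-(q * p)) := integral_nonneg fun x => by positivity
  refine ⟨B + ∫ x : ℝ, (1 + |x|) ^ (-(q * p)), by positivity, ?_⟩
  intro μ _ h f a b y₀ K hd hfm hf0 hfp ha hK htail hdom
  set A : Set ℝ := {x | y₀ < a * x + b} with hA
  have hAm : MeasurableSet A := measurableSet_lt measurable_const (by fun_prop)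
  have hmom := hB (μ.restrict A) (by simpa using prob_le_one) htail
  rw [hd.2.2, restrict_withDensity hAm, lintegral_withDensity_eq_lintegral_mul _
    hd.1.ennreal_ofReal (by fun_prop)] at hmom
  have hh := hd.2.1
  have h1 : ∫⁻ x in A, ENNReal.ofReal (h x ^ p) ≤
      ENNReal.ofReal B + ENNReal.ofReal (∫ x : ℝ, (1 + |x|) ^ (-(q * p))) := by
    rw [ofReal_integral_eq_lintegral_ofReal hint (ae_of_all _ fun x => by positivity)]
    refine le_trans ?_ (add_le_add hmom (setLIntegral_le_lintegral A _))
    rw [← lintegral_add_right _ (by fun_prop)]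
    refine lintegral_mono fun x => ?_
    have hx : 0 < 1 + |x| := by positivity
    simp only [Pi.mul_apply]
    rw [← ENNReal.ofReal_mul (hh x), ← ENNReal.ofReal_add (mul_nonneg (hh x) (by positivity))
      (by positivity)]
    apply ENNReal.ofReal_le_ofReal
    have := rpow_le_mul_rpow_add_rpow (hh x) (t := (1 + |x|) ^ (-q)) (by positivity) hp hp1.le
    rw [← Real.rpow_mul hx.le, ← Real.rpow_mul hx.le] at this
    rwa [show -(q * p) = -q * p by ring, show q * (1 - p) = -q * (p - 1) by ring]
  have h2 : ∫⁻ x in Aᶜ, ENNReal.ofReal (h x ^ p) ≤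
      ENNReal.ofReal (K ^ p * a ^ (p - 1) * ∫ x, f x ^ p) := by
    rw [← lintegral_rpow_comp_affine (b := b) ha hK hf0 hfp]
    refine le_trans ?_ (setLIntegral_le_lintegral Aᶜ _)
    refine lintegral_mono_ae ((ae_restrict_iff' hAm.compl).2 ?_)
    filter_upwards [density_le_of_law_le hd hfm hK ha hdom hf0] with x hx hxA
    exact ENNReal.ofReal_le_ofReal (Real.rpow_le_rpow (hh x) (hx (not_lt.1 hxA)) hp.le)
  rw [← lintegral_add_compl _ hAm]
  refine (add_le_add h1 h2).trans_eq ?_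
  have hf1 : 0 ≤ ∫ x, f x ^ p := integral_nonneg fun x => Real.rpow_nonneg (hf0 x) _
  rw [← ENNReal.ofReal_add hB0 hI0, ← ENNReal.ofReal_add (by positivity) (by positivity)]

/-- A density with mass at least `1/2` on `[-R, R]` has a `β`-integral bounded below. -/
theorem le_integral_rpow_of_half_le {β R : ℝ} (hβ : 1 < β) (hR : 0 < R) (hh : ∀ x, 0 ≤ h x)
    (hi : Integrable h) (hiβ : Integrable fun x => h x ^ β)
    (hmass : 1 / 2 ≤ ∫ x in Set.Icc (-R) R, h x) :
    1 / 4 * (8 * R) ^ (1 - β) ≤ ∫ x, h x ^ β := by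
  -- The constant `t` then contributes `2 R t = 1/4`, half of the available mass.
  set t : ℝ := (8 * R)⁻¹ with ht
  have ht0 : 0 < t := by positivity
  have hc : Integrable (fun _ : ℝ => t) (volume.restrict (Set.Icc (-R) R)) :=
    integrableOn_const (by simp)
  have h1 : ∫ x in Set.Icc (-R) R, h x ≤ ∫ x in Set.Icc (-R) R, (t + t ^ (1 - β) * h x ^ β) :=
    setIntegral_mono hi.integrableOn
      (hc.add (hiβ.integrableOn.const_mul _))
      fun x => le_add_rpow_mul_rpow (hh x) ht0 hβ
  rw [integral_add hc (hiβ.integrableOn.const_mul _),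
    integral_const_mul, setIntegral_const, smul_eq_mul] at h1
  have h2 : ∫ x in Set.Icc (-R) R, h x ^ β ≤ ∫ x, h x ^ β :=
    setIntegral_le_integral hiβ (ae_of_all _ fun x => Real.rpow_nonneg (hh x) _)
  have h3 : volume.real (Set.Icc (-R) R) * t = 1 / 4 := by
    rw [Real.volume_real_Icc_of_le (by linarith), ht]
    field_simp
    norm_num
  have h4 : t ^ (1 - β) = ((8 * R) ^ (1 - β))⁻¹ := by
    rw [ht, Real.inv_rpow (by positivity)]
  have h5 : 0 < (8 * R) ^ (1 - β) := by positivity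
  rw [h3, h4, inv_mul_eq_div] at h1
  have h6 : 1 / 4 ≤ (∫ x in Set.Icc (-R) R, h x ^ β) / (8 * R) ^ (1 - β) := by linarith
  rw [le_div_iff₀ h5] at h6
  linarith

end Bounds

/-! ### From uniform bounds to entropies -/

theorem renyiEntropy_eq {β : ℝ} (hβ : β ≠ 0) {h : ℝ → ℝ} (hh : ∀ x, 0 ≤ h x) :
    renyiEntropy β h = 1 / (1 - β) * Real.log (∫ x, h x ^ β) := by
  rw [renyiEntropy, setIntegral_eq_integral_of_forall_compl_eq_zero]
  intro x hx
  have : h x = 0 := le_antisymm (not_lt.1 hx) (hh x)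
  rw [this, Real.zero_rpow hβ]

theorem integrable_rpow_of_abs_sub_le {g h : ℝ → ℝ} {β ε : ℝ} (hβ : 1 < β) (hg0 : ∀ x, 0 ≤ g x)
    (hgi : Integrable g) (hgβ : Integrable fun x => g x ^ β) (hh : ∀ x, 0 ≤ h x)
    (hm : Measurable h) (hi : Integrable h) (hε : ∀ x, |h x - g x| ≤ ε) :
    Integrable (fun x => h x ^ β) ∧
      ∫ x, h x ^ β ≤ 2 ^ β * (∫ x, g x ^ β) + 2 ^ β * ε ^ (β - 1) * ((∫ x, g x) + ∫ x, h x) := by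
  have hgh : Integrable fun x => g x + h x := hgi.add hi
  have hdom : Integrable fun x => 2 ^ β * (g x ^ β + ε ^ (β - 1) * (g x + h x)) :=
    (hgβ.add (hgh.const_mul _)).const_mul _
  have hle : ∀ x, h x ^ β ≤ 2 ^ β * (g x ^ β + ε ^ (β - 1) * (g x + h x)) := fun x =>
    rpow_le_of_abs_sub_le (hg0 x) (hh x) hβ (hε x)
  have hint : Integrable fun x => h x ^ β := by
    refine hdom.mono' (hm.pow_const β).aestronglyMeasurable (ae_of_all _ fun x => ?_)
    rw [Real.norm_of_nonneg (Real.rpow_nonneg (hh x) _)]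
    exact hle x
  refine ⟨hint, (integral_mono hint hdom hle).trans_eq ?_⟩
  rw [integral_const_mul, integral_add hgβ (hgh.const_mul _), integral_const_mul,
    integral_add hgi hi]
  ring

theorem integrable_rpow_sub_one_of_two_le {h : ℝ → ℝ} {β : ℝ} (hβ : 2 ≤ β)
    (hh : ∀ x, 0 ≤ h x) (hm : Measurable h) (hi : Integrable h)
    (hiβ : Integrable fun x => h x ^ β) :
    Integrable (fun x => h x ^ (β - 1)) ∧
      ∫ x, h x ^ (β - 1) ≤ (∫ x, h x) + ∫ x, h x ^ β := by
  have hle : ∀ x, h x ^ (β - 1) ≤ h x + h x ^ β := fun x => by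
    simpa using rpow_le_add_rpow_of_le (hh x) one_pos (by linarith : 1 ≤ β - 1)
      (by linarith : β - 1 ≤ β)
  have hint : Integrable fun x => h x ^ (β - 1) := by
    refine (hi.add hiβ).mono' (hm.pow_const _).aestronglyMeasurable (ae_of_all _ fun x => ?_)
    rw [Real.norm_of_nonneg (Real.rpow_nonneg (hh x) _)]
    exact hle x
  exact ⟨hint, (integral_mono hint (hi.add hiβ) hle).trans_eq (integral_add hi hiβ)⟩

theorem abs_integral_rpow_sub_le {g h : ℝ → ℝ} {β s : ℝ} (hβ : 1 < β) (hg0 : ∀ x, 0 ≤ g x)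
    (hh : ∀ x, 0 ≤ h x) (hgβ : Integrable fun x => g x ^ β) (hhβ : Integrable fun x => h x ^ β)
    (hgp : Integrable fun x => g x ^ (β - 1)) (hhp : Integrable fun x => h x ^ (β - 1))
    (hs : ∀ x, |h x - g x| ≤ s) :
    |(∫ x, h x ^ β) - ∫ x, g x ^ β| ≤
      β * ((∫ x, h x ^ (β - 1)) + ∫ x, g x ^ (β - 1)) * s := by
  rw [← integral_sub hhβ hgβ]
  refine abs_integral_le_integral_abs.trans ?_
  calc ∫ x, |h x ^ β - g x ^ β|
      ≤ ∫ x, β * (h x ^ (β - 1) + g x ^ (β - 1)) * s := by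
        refine integral_mono (hhβ.sub hgβ).abs (((hhp.add hgp).const_mul β).mul_const s) fun x => ?_
        refine (abs_rpow_sub_rpow_le (hh x) (hg0 x) hβ).trans ?_
        have h1 := Real.rpow_nonneg (hh x) (β - 1)
        have h2 := Real.rpow_nonneg (hg0 x) (β - 1)
        exact mul_le_mul_of_nonneg_left (hs x) (by positivity)
    _ = _ := by
        rw [integral_mul_const, integral_const_mul, integral_add hhp hgp]

/-- Uniform bounds on `∫ gₙ^(β-1)` and `∫ gₙ^β` turn the sup-distance of the densities into a bound
for the distance of the Rényi entropies. -/
theorem entropy_bound_of_uniform_bounds {g : ℝ → ℝ} {gn : ℕ → ℝ → ℝ} {β ε B c : ℝ} (hβ : 1 < β)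
    (hB : 0 ≤ B) (hc : 0 < c) (hg0 : ∀ x, 0 ≤ g x) (hgm : Measurable g)
    (hgβ : Integrable fun x => g x ^ β)
    (hgp : Integrable fun x => g x ^ (β - 1)) (hcg : c ≤ ∫ x, g x ^ β)
    (hev : ∀ᶠ n in atTop, (∀ x, 0 ≤ gn n x) ∧ Measurable (gn n) ∧
      (∀ x, |gn n x - g x| < ε) ∧ gn n ≠ g ∧ Integrable (fun x => gn n x ^ β) ∧
      Integrable (fun x => gn n x ^ (β - 1)) ∧ ∫ x, gn n x ^ (β - 1) ≤ B ∧
      c ≤ ∫ x, gn n x ^ β) :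
    ∃ M M₂ : ℝ, 0 < M ∧ 0 < M₂ ∧ ∀ᶠ n : ℕ in atTop,
      Integrable (fun x => gn n x ^ β) ∧
      Integrable (fun x => |gn n x - g x| ^ (β - 1)) ∧
      (∫ x, |gn n x - g x| ^ (β - 1)) < M₂ ∧
      |renyiEntropy β (gn n) - renyiEntropy β g| < M * ⨆ x, |gn n x - g x| := by
  set G := ∫ x, g x ^ (β - 1) with hGdef
  have hG : 0 ≤ G := integral_nonneg fun x => Real.rpow_nonneg (hg0 x) _
  set M := 1 / (β - 1) * (c⁻¹ * (β * (B + G))) with hM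
  have hβ1 : 0 < β - 1 := by linarith
  have hM0 : 0 ≤ M := by positivity
  refine ⟨M + 1, B + G + 1, by positivity, by positivity, ?_⟩
  filter_upwards [hev] with n ⟨hh, hm, hε, hne, hhβ, hhp, hhB, hcn⟩
  -- Without boundedness the real supremum would be the default `0`.
  have hbdd : BddAbove (Set.range fun x => |gn n x - g x|) := ⟨ε, by
    rintro _ ⟨x, rfl⟩
    exact (hε x).le⟩
  have hle : ∀ x, |gn n x - g x| ≤ ⨆ x, |gn n x - g x| := fun x => le_ciSup hbdd x
  -- Needed for strictness: the final constant `M + 1` beats `M` only when the supremum is positive.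
  have hspos : 0 < ⨆ x, |gn n x - g x| := by
    obtain ⟨x, hx⟩ := Function.ne_iff.1 hne
    exact (abs_pos.2 (sub_ne_zero.2 hx)).trans_le (hle x)
  set s := ⨆ x, |gn n x - g x| with hs
  have hdle : ∀ x, |gn n x - g x| ^ (β - 1) ≤ gn n x ^ (β - 1) + g x ^ (β - 1) := fun x =>
    abs_sub_rpow_le (hh x) (hg0 x) hβ1
  have hdi : Integrable fun x => |gn n x - g x| ^ (β - 1) := by
    refine (hhp.add hgp).mono' ((hm.sub hgm).abs.pow_const _).aestronglyMeasurable (ae_of_all _ fun x => ?_)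
    rw [Real.norm_of_nonneg (by positivity)]
    exact hdle x
  refine ⟨hhβ, hdi, ?_, ?_⟩
  · have h1 := (integral_mono hdi (hhp.add hgp) hdle).trans_eq (integral_add hhp hgp)
    linarith
  · rw [renyiEntropy_eq (by linarith) hh, renyiEntropy_eq (by linarith) hg0, ← mul_sub, abs_mul]
    have h1 : |1 / (1 - β)| = 1 / (β - 1) := by
      rw [abs_div, abs_one, abs_sub_comm, abs_of_pos hβ1]
    have h2 := abs_log_sub_log_le hc hcn hcg
    have h3 := abs_integral_rpow_sub_le hβ hg0 hh hgβ hhβ hgp hhp hle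
    rw [h1]
    calc 1 / (β - 1) * |Real.log (∫ x, gn n x ^ β) - Real.log (∫ x, g x ^ β)|
        ≤ 1 / (β - 1) * (c⁻¹ * (β * ((∫ x, gn n x ^ (β - 1)) + G) * s)) := by
          gcongr
          exact h2.trans (mul_le_mul_of_nonneg_left h3 (by positivity))
      _ ≤ 1 / (β - 1) * (c⁻¹ * (β * (B + G) * s)) := by gcongr
      _ = M * s := by rw [hM]; ring
      _ < (M + 1) * s := by linarith

/-- Since `p < 1`, `a ^ (p-1)` is at most `(c/n)^(p-1)`, so the powers of `n` combine to exactly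
`n`, and `n (q^p)^(n-1)` is bounded. -/
theorem exists_mul_pow_rpow_bound {q c p : ℝ} (hq0 : 0 ≤ q) (hq1 : q < 1) (hc : 0 < c) (hp : 0 < p)
    (hp1 : p < 1) : ∃ D : ℝ, 0 ≤ D ∧ ∀ (n : ℕ) (a : ℝ), 0 < n → c / n ≤ a →
      (n * q ^ (n - 1)) ^ p * a ^ (p - 1) ≤ D := by
  have hqp0 : 0 ≤ q ^ p := by positivity
  have hqp1 : q ^ p < 1 := Real.rpow_lt_one hq0 hq1 hp
  have ht : Tendsto (fun m : ℕ => ((m:ℝ) + 1) * (q ^ p) ^ m) atTop (𝓝 0) := by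
    have := (tendsto_self_mul_const_pow_of_lt_one hqp0 hqp1).add
      (tendsto_pow_atTop_nhds_zero_of_lt_one hqp0 hqp1)
    simpa [add_mul] using this
  obtain ⟨D, hD⟩ := ht.bddAbove_range
  have hD0 : 0 ≤ D := le_trans (by positivity) (hD ⟨0, rfl⟩)
  refine ⟨c ^ (p - 1) * D, by positivity, fun n a hn ha => ?_⟩
  have hn0 : (0:ℝ) < n := by exact_mod_cast hn
  have h1 : a ^ (p - 1) ≤ (c / n) ^ (p - 1) :=
    Real.rpow_le_rpow_of_nonpos (by positivity) ha (by linarith)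
  have h2 : ((n:ℝ) * q ^ (n - 1)) ^ p = n ^ p * (q ^ p) ^ (n - 1) := by
    rw [Real.mul_rpow hn0.le (by positivity), ← Real.rpow_natCast, ← Real.rpow_natCast,
      ← Real.rpow_mul hq0, ← Real.rpow_mul hq0, mul_comm p]
  have h3 : (n:ℝ) * (q ^ p) ^ (n - 1) ≤ D := by
    have := hD ⟨n - 1, rfl⟩
    simpa [Nat.cast_sub hn] using this
  calc ((n:ℝ) * q ^ (n - 1)) ^ p * a ^ (p - 1)
      ≤ (n ^ p * (q ^ p) ^ (n - 1)) * (c / n) ^ (p - 1) := by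
        rw [h2]; gcongr
    _ = c ^ (p - 1) * (n ^ p / n ^ (p - 1) * (q ^ p) ^ (n - 1)) := by
        rw [Real.div_rpow hc.le hn0.le]; ring
    _ = c ^ (p - 1) * (n * (q ^ p) ^ (n - 1)) := by
        rw [← Real.rpow_sub hn0]; simp
    _ ≤ c ^ (p - 1) * D := by gcongr

/-- Outside `[-R, R]` lies either mass below the level `y₀`, which is `F(y₀)^n`, or mass in the
controlled tails; each is at most `1/4`. -/
theorem half_le_integral_Icc {μ : Measure ℝ} [IsProbabilityMeasure μ] {h F : ℝ → ℝ}
    {a b y₀ R : ℝ} {n : ℕ} (hd : IsDensity h μ)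
    (hcdf : ∀ x, μ.real (Set.Iic x) = F (a * x + b) ^ n) (ha : 0 < a)
    (hlow : F y₀ ^ n ≤ 1 / 4)
    (htail : μ.restrict {x | y₀ < a * x + b} {x | R ≤ |x|} ≤ ENNReal.ofReal (1 / 4)) :
    1 / 2 ≤ ∫ x in Set.Icc (-R) R, h x := by
  have hm : MeasurableSet {x : ℝ | R ≤ |x|} := measurableSet_le measurable_const (by fun_prop)
  rw [Measure.restrict_apply hm] at htail
  have h1 : μ.real ({x | R ≤ |x|} ∩ {x | y₀ < a * x + b}) ≤ 1 / 4 :=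
    ENNReal.toReal_le_of_le_ofReal (by norm_num) htail
  have h2 : μ.real (Set.Iic ((y₀ - b) / a)) ≤ 1 / 4 := by
    rw [hcdf, show a * ((y₀ - b) / a) + b = y₀ by field_simp; ring]
    exact hlow
  have hsub : (Set.Icc (-R) R)ᶜ ⊆
      Set.Iic ((y₀ - b) / a) ∪ ({x | R ≤ |x|} ∩ {x | y₀ < a * x + b}) := by
    intro x hx
    rcases le_or_gt (a * x + b) y₀ with hxy | hxy
    · left
      rw [Set.mem_Iic, le_div_iff₀ ha]
      linarith
    · right
      refine ⟨?_, hxy⟩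
      by_contra hcon
      exact hx (abs_le.1 (not_le.1 hcon).le)
  have h3 : μ.real (Set.Icc (-R) R)ᶜ ≤ 1 / 2 := by
    refine (measureReal_mono hsub).trans ((measureReal_union_le _ _).trans ?_)
    linarith
  rw [probReal_compl_eq_one_sub measurableSet_Icc] at h3
  rw [← hd.measureReal_eq measurableSet_Icc]
  linarith

theorem exp_neg_one_ne_one_sub_pow {n : ℕ} (hn : 1 < n) :
    (1 - 1 / (n : ℝ)) ^ n ≠ Real.exp (-1) := by
  have hn1 : (1:ℝ) < n := by exact_mod_cast hn
  have h1 : 1 / (n:ℝ) < 1 := by rw [div_lt_one (by linarith)]; exact hn1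
  have h2 : 0 < 1 / (n:ℝ) := by positivity
  have h3 : 1 - 1 / (n:ℝ) < Real.exp (-(1 / (n:ℝ))) := by
    have := Real.add_one_lt_exp (x := -(1 / (n:ℝ))) (by linarith)
    linarith
  have h4 : (1 - 1 / (n:ℝ)) ^ n < Real.exp (-(1 / (n:ℝ))) ^ n :=
    pow_lt_pow_left₀ h3 (by linarith) (by omega)
  rw [← Real.exp_nat_mul, show (n:ℝ) * -(1 / (n:ℝ)) = -1 by field_simp] at h4
  exact h4.ne

/-- The entropy bound for normalized maxima, from uniform control of the tails. -/
theorem entropy_bound_of_tailControl {Ω : Type*} [MeasurableSpace Ω] {P : Measure Ω}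
    [IsProbabilityMeasure P] {X : ℕ → Ω → ℝ} (hXm : ∀ i, Measurable (X i))
    (hXindep : iIndepFun X P) (hXid : ∀ i, IdentDistrib (X i) (X 0) P P)
    {F : ℝ → ℝ} (hF : ∀ x, F x = P.real {ω | X 0 ω ≤ x})
    {f : ℝ → ℝ} (hf : IsDensity f (P.map (X 0))) {β : ℝ} (hβ : 1 < β)
    {a b : ℕ → ℝ} {g : ℝ → ℝ} {k : ℝ} (hk : 0 < k) (hkβ : 1 < (β - 1) * (1 + k))
    (htc : TailControl F a b k) {x₀ : ℝ}
    (hx₀ : ∀ n, a n * x₀ + b n = quantile F (1 - 1 / (n : ℝ)))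
    (hg0 : ∀ x, 0 ≤ g x) (hgm : Measurable g) (hgi : Integrable g)
    (hgx₀ : ∫ x in Set.Iic x₀, g x = Real.exp (-1))
    (hgp : β < 2 → Integrable fun x => g x ^ (β - 1))
    {gn : ℕ → ℝ → ℝ}
    (hgn : ∀ᶠ n : ℕ in atTop,
      IsDensity (gn n) (P.map (fun ω => (partialMax X n ω - b n) / a n)))
    (hsup : ∃ ε : ℝ, 0 < ε ∧ ∃ N : ℕ, ∀ n ≥ N, ∀ x, |gn n x - g x| < ε)
    (hg : Integrable (fun x => g x ^ β)) (hfβ : Integrable (fun x => f x ^ (β - 1))) :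
    ∃ M M₂ : ℝ, 0 < M ∧ 0 < M₂ ∧ ∀ᶠ n : ℕ in atTop,
      Integrable (fun x => gn n x ^ β) ∧
      Integrable (fun x => |gn n x - g x| ^ (β - 1)) ∧
      (∫ x, |gn n x - g x| ^ (β - 1)) < M₂ ∧
      |renyiEntropy β (gn n) - renyiEntropy β g| < M * ⨆ x, |gn n x - g x| := by
  have hFd := isDistributionWithDensity (hXm 0) hF hf
  obtain ⟨y₀, C, c, hy₀, hC, hc, htc⟩ := htc
  obtain ⟨ε, hε, N, hN⟩ := hsup
  set p := β - 1 with hp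
  have hp0 : 0 < p := by rw [hp]; linarith
  have hgp' : Integrable fun x => g x ^ p := by
    rcases lt_or_ge β 2 with h2 | h2
    · exact hgp h2
    · exact (integrable_rpow_sub_one_of_two_le h2 hg0 hgm hgi hg).1
  set C' := 2 * C + 2 ^ k with hC'
  have hC'0 : 0 ≤ C' := by positivity
  have hbasic : ∀ᶠ n : ℕ in atTop, 1 < n ∧ 0 < a n ∧ c / n ≤ a n ∧
      IsDensity (gn n) (P.map (fun ω => (partialMax X n ω - b n) / a n)) ∧
      (∀ x, |gn n x - g x| < ε) ∧
      (∀ t, 0 ≤ t → (P.map (fun ω => (partialMax X n ω - b n) / a n)).restrict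
        {x | y₀ < a n * x + b n} {x | t ≤ |x|} ≤ ENNReal.ofReal (C' * (1 + t) ^ (-k))) := by
    filter_upwards [htc, hgn, eventually_ge_atTop N, eventually_gt_atTop 1]
      with n ⟨hca, hr, hl⟩ hd hnN hn1
    have hn0 : (0:ℝ) < n := by positivity
    have ha : 0 < a n := (div_pos hc hn0).trans_le hca
    have := Measure.isProbabilityMeasure_map (μ := P)
      (measurable_normalizedMax hXm n (a n) (b n)).aemeasurable
    refine ⟨hn1, ha, hca, hd, hN n hnN, fun t ht => ?_⟩
    exact restrict_tail_le hd hFd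
      (normalizedMax_law_Iic hXm hXindep hXid hF (by omega) ha (b n)) (by omega) ha hC hk hr hl ht
  have hβbound : ∃ Bβ : ℝ, ∀ᶠ n : ℕ in atTop, Integrable (fun x => gn n x ^ β) ∧
      ∫ x, gn n x ^ β ≤ Bβ := by
    refine ⟨2 ^ β * (∫ x, g x ^ β) + 2 ^ β * ε ^ (β - 1) * ((∫ x, g x) + 1), ?_⟩
    filter_upwards [hbasic] with n ⟨_, _, _, hd, hε', _⟩
    have := Measure.isProbabilityMeasure_map (μ := P)
      (measurable_normalizedMax hXm n (a n) (b n)).aemeasurable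
    have h1 := integrable_rpow_of_abs_sub_le hβ hg0 hgi hg hd.2.1 hd.1 hd.integrable
      fun x => (hε' x).le
    rwa [hd.integral_eq_one] at h1
  obtain ⟨Bβ, hBβ⟩ := hβbound
  have hpbound : ∃ B : ℝ, 0 ≤ B ∧ ∀ᶠ n : ℕ in atTop, Integrable (fun x => gn n x ^ p) ∧
      ∫ x, gn n x ^ p ≤ B := by
    rcases lt_or_ge β 2 with h2 | h2
    · have hp1 : p < 1 := by rw [hp]; linarith
      obtain ⟨B, hB0, hB⟩ := exists_lintegral_rpow_bound C' k hp0 hp1 hC'0 hkβ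
      obtain ⟨D, hD0, hD⟩ := exists_mul_pow_rpow_bound (hFd.nonneg y₀) hy₀ hc hp0 hp1
      have hfi : 0 ≤ ∫ x, f x ^ p := integral_nonneg fun x => Real.rpow_nonneg (hf.2.1 x) _
      refine ⟨B + D * ∫ x, f x ^ p, by positivity, ?_⟩
      filter_upwards [hbasic] with n ⟨hn1, ha, hca, hd, _, htail⟩
      have := Measure.isProbabilityMeasure_map (μ := P)
        (measurable_normalizedMax hXm n (a n) (b n)).aemeasurable
      have hK : 0 ≤ n * F y₀ ^ (n - 1) :=
        mul_nonneg (Nat.cast_nonneg n) (pow_nonneg (hFd.nonneg y₀) _)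
      have h1 := hB _ (gn n) f (a n) (b n) y₀ (n * F y₀ ^ (n - 1)) hd hf.1 hf.2.1 hfβ ha hK htail
        fun s hs => normalizedMax_law_inter_le hXm hXindep hXid hF hf (by omega) ha (b n) y₀ hs
      have h3 : ∫⁻ x, ENNReal.ofReal (gn n x ^ p) ≤ ENNReal.ofReal (B + D * ∫ x, f x ^ p) := by
        refine h1.trans (ENNReal.ofReal_le_ofReal ?_)
        have := hD n (a n) (by omega) hca
        gcongr
      have hnn : ∀ x, 0 ≤ gn n x ^ p := fun x => Real.rpow_nonneg (hd.2.1 x) _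
      have hmeas : Measurable fun x => gn n x ^ p := hd.1.pow_const p
      refine ⟨⟨hmeas.aestronglyMeasurable, ?_⟩, ?_⟩
      · rw [hasFiniteIntegral_iff_ofReal (ae_of_all _ hnn)]
        exact h3.trans_lt ENNReal.ofReal_lt_top
      · rw [integral_eq_lintegral_of_nonneg_ae (ae_of_all _ hnn) hmeas.aestronglyMeasurable]
        exact ENNReal.toReal_le_of_le_ofReal (by positivity) h3
    · refine ⟨1 + |Bβ|, by positivity, ?_⟩
      filter_upwards [hbasic, hBβ] with n ⟨_, _, _, hd, _, _⟩ ⟨hi, hle⟩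
      have := Measure.isProbabilityMeasure_map (μ := P)
        (measurable_normalizedMax hXm n (a n) (b n)).aemeasurable
      obtain ⟨h3, h4⟩ := integrable_rpow_sub_one_of_two_le h2 hd.2.1 hd.1 hd.integrable hi
      refine ⟨h3, h4.trans ?_⟩
      rw [hd.integral_eq_one]
      linarith [le_abs_self Bβ]
  obtain ⟨B, hB0, hB⟩ := hpbound
  have hlower : ∃ c' : ℝ, 0 < c' ∧ ∀ᶠ n : ℕ in atTop, c' ≤ ∫ x, gn n x ^ β := by
    have h1 : Tendsto (fun R : ℝ => C' * (1 + R) ^ (-k)) atTop (𝓝 0) := by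
      have := ((tendsto_rpow_neg_atTop hk).comp
        (tendsto_atTop_add_const_left atTop (1:ℝ) tendsto_id)).const_mul C'
      simpa using this
    obtain ⟨R, hR, hR0⟩ := ((h1.eventually (gt_mem_nhds (by norm_num : (0:ℝ) < 1 / 4))).and
      (eventually_gt_atTop 0)).exists
    have h2 := (tendsto_pow_atTop_nhds_zero_of_lt_one (hFd.nonneg y₀) hy₀).eventually
      (gt_mem_nhds (by norm_num : (0:ℝ) < 1 / 4))
    refine ⟨1 / 4 * (8 * R) ^ (1 - β), by positivity, ?_⟩
    filter_upwards [hbasic, hBβ, h2] with n ⟨hn1, ha, _, hd, _, htail⟩ ⟨hi, _⟩ hlow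
    have := Measure.isProbabilityMeasure_map (μ := P)
      (measurable_normalizedMax hXm n (a n) (b n)).aemeasurable
    refine le_integral_rpow_of_half_le hβ hR0 hd.2.1 hd.integrable hi ?_
    exact half_le_integral_Icc hd
      (normalizedMax_law_Iic hXm hXindep hXid hF (by omega) ha (b n)) ha hlow.le
      ((htail R hR0.le).trans (ENNReal.ofReal_le_ofReal hR.le))
  obtain ⟨c₁, hc₁, hlow⟩ := hlower
  have hgpos : 0 < ∫ x, g x ^ β := by
    rw [integral_pos_iff_support_of_nonneg (fun x => Real.rpow_nonneg (hg0 x) _) hg]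
    -- If `g` vanished almost everywhere, its mass up to `x₀` could not be `e⁻¹`.
    by_contra hcon
    have h0 : g =ᵐ[volume] 0 := by
      have : ∀ᵐ x, x ∉ Function.support fun x => g x ^ β :=
        measure_eq_zero_iff_ae_notMem.1 (le_antisymm (not_lt.1 hcon) zero_le)
      filter_upwards [this] with x hx
      exact (Real.rpow_eq_zero (y := β) (hg0 x) (by linarith)).1 (by simpa using hx)
    rw [integral_congr_ae (ae_restrict_of_ae h0)] at hgx₀
    simp only [Pi.zero_apply, integral_zero] at hgx₀
    exact (Real.exp_pos _).ne hgx₀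
  refine entropy_bound_of_uniform_bounds (ε := ε) (B := B) (c := min c₁ (∫ x, g x ^ β)) hβ hB0
    (lt_min hc₁ hgpos) hg0 hgm hg hgp' (min_le_right _ _) ?_
  filter_upwards [hbasic, hBβ, hB, hlow] with n ⟨hn1, ha, _, hd, hε', _⟩ ⟨hiβ, _⟩ ⟨hip, hipB⟩ hln
  refine ⟨hd.2.1, hd.1, hε', fun heq => ?_, hiβ, hip, hipB, (min_le_left _ _).trans hln⟩
  -- If `gₙ = g`, the mass up to `x₀` would equal both `(1 - 1/n)^n` and `e⁻¹`.
  have h1 := hd.measureReal_eq (measurableSet_Iic (a := x₀))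
  rw [heq, hgx₀, normalizedMax_law_Iic hXm hXindep hXid hF (by omega) ha (b n), hx₀,
    hFd.apply_quantile_one_sub hn1] at h1
  exact exp_neg_one_ne_one_sub_pow hn1 h1

end RenyiExtremes

theorem mainTheorem3 {Ω : Type*} [MeasurableSpace Ω] (P : Measure Ω) [IsProbabilityMeasure P]
    -- iid random variables with distribution function `F` and density `f`
    (X : ℕ → Ω → ℝ) (hXm : ∀ i, Measurable (X i)) (hXindep : iIndepFun X P)
    (hXid : ∀ i, IdentDistrib (X i) (X 0) P P)
    (F : ℝ → ℝ) (hF : ∀ x, F x = P.real {ω | X 0 ω ≤ x})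
    (f : ℝ → ℝ) (hf : IsDensity f (P.map (X 0)))
    (β : ℝ) (hβ : 1 < β)
    -- norming constants and limit density: Fréchet or Gumbel, under the von Mises condition
    (a b : ℕ → ℝ) (g : ℝ → ℝ)
    (hG : (∃ α : ℝ, 0 < α ∧ VonMisesFrechet F f α ∧ (1 + α)⁻¹ < β - 1 ∧
            (∀ n, a n = quantile F (1 - 1 / (n : ℝ))) ∧ (∀ n, b n = 0) ∧
            g = frechetDensity α) ∨
          (VonMisesGumbel F f ∧
            (∀ n, b n = quantile F (1 - 1 / (n : ℝ))) ∧ (∀ n, a n = auxFun F (b n)) ∧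
            g = gumbelDensity))
    -- `gn n` is a density of the normalized maximum
    (gn : ℕ → ℝ → ℝ)
    (hgn : ∀ᶠ n : ℕ in atTop,
      IsDensity (gn n) (P.map (fun ω => (partialMax X n ω - b n) / a n)))
    -- the sup-norm distance is bounded for large `n`
    (hsup : ∃ ε : ℝ, 0 < ε ∧ ∃ N : ℕ, ∀ n ≥ N, ∀ x, |gn n x - g x| < ε)
    (hg : Integrable (fun x => g x ^ β)) (hfβ : Integrable (fun x => f x ^ (β - 1))) :
    ∃ M M₂ : ℝ, 0 < M ∧ 0 < M₂ ∧ ∀ᶠ n : ℕ in atTop,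
      Integrable (fun x => gn n x ^ β) ∧
      Integrable (fun x => |gn n x - g x| ^ (β - 1)) ∧
      (∫ x, |gn n x - g x| ^ (β - 1)) < M₂ ∧
      |renyiEntropy β (gn n) - renyiEntropy β g| < M * ⨆ x, |gn n x - g x| := by
  have hFd := isDistributionWithDensity (hXm 0) hF hf
  rcases hG with ⟨α, hα, hvm, hαβ, ha, hb, rfl⟩ | ⟨hvm, hb, ha, rfl⟩
  · have hβ1 : 0 < β - 1 := by linarith
    have hk : (β - 1)⁻¹ - 1 < α := by
      rw [inv_lt_comm₀ (by linarith) hβ1] at hαβ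
      linarith
    -- The assumption `(1 + α)⁻¹ < β - 1` leaves room for a tail order `k < α` with `(β-1)(1+k) >
    -- 1`; the maximum with `0` keeps `k` positive.
    obtain ⟨k, hk1, hkα⟩ := exists_between (max_lt hk hα)
    have hk0 : 0 < k := (le_max_right _ _).trans_lt hk1
    have hkβ : 1 < (β - 1) * (1 + k) := by
      have h1 : (β - 1)⁻¹ < 1 + k := by linarith [(le_max_left _ _).trans_lt hk1]
      rwa [inv_lt_iff_one_lt_mul₀ hβ1, mul_comm] at h1
    exact entropy_bound_of_tailControl hXm hXindep hXid hF hf hβ hk0 hkβ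
      (hFd.tailControl_of_frechet hα hvm hk0 hkα ha hb) (x₀ := 1)
      (fun n => by rw [hb, ha, mul_one, add_zero]) (frechetDensity_nonneg hα)
      (measurable_frechetDensity α) (integrable_frechetDensity hα)
      (integral_Iic_one_frechetDensity hα)
      (fun h2 => integrable_frechetDensity_rpow hα hβ1 (by linarith) hαβ) hgn hsup hg hfβ
  · have hβ1 : 0 < β - 1 := by linarith
    -- Every order `k ≥ 1` is available here; `k = 1 + (β-1)⁻¹` makes the product `2 (β-1) + 1`.
    have hkβ : 1 < (β - 1) * (1 + (1 + (β - 1)⁻¹)) := by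
      have h1 : (β - 1) * (β - 1)⁻¹ = 1 := mul_inv_cancel₀ hβ1.ne'
      linarith
    have hinv : 0 < (β - 1)⁻¹ := inv_pos.2 hβ1
    exact entropy_bound_of_tailControl hXm hXindep hXid hF hf hβ (by linarith) hkβ
      (hFd.tailControl_of_gumbel hvm (by linarith) hb ha) (x₀ := 0)
      (fun n => by rw [hb, mul_zero, zero_add]) gumbelDensity_nonneg
      measurable_gumbelDensity integrable_gumbelDensity integral_Iic_zero_gumbelDensity
      (fun h2 => integrable_gumbelDensity_rpow hβ1 (by linarith)) hgn hsup hg hfβ
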